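/- **Theorem 4 (Correlations in systems at finite temperature).** Let $G=(L,E)$ be a finite connected simple graph with graph distance $\mathrm{dist}$, and let $V_x,V_p\in\mathbb R^{L\times L}$ be positive definite symmetric matrices with $[V_x,V_p]=0$ that have finite range $m\in\mathbb N$, $m\ge 1$: $(V_x)_{i,j}=(V_p)_{i,j}=0$ whenever $\mathrm{dist}(i,j)>m/2$. Consider on $L^2(\mathbb R^{L})$ the Hamiltonian $$\hat H=\hat p^{T}V_p\,\hat p+\hat x^{T}V_x\,\hat x=\sum_{i,j\in L}\bigl((V_p)_{i,j}\,\hat p_i\hat p_j+(V_x)_{i,j}\,\hat x_i\hat x_j\bigr),$$ where $\hat x_i$ (multiplication by the $i$-th coordinate) and $\hat p_i=-\mathrm i\,\partial/\partial x_i$ are the canonical coordinates. Let $\|\cdot\|$ be the operator norm, let $\Delta E:=2\lambda_{\min}^{1/2}(V_xV_p)$, where $\lambda_{\min}$ is the smallest eigenvalue, and let $v_{r}:=\sup_{i\in L}|\{l\in L:\mathrm{dist}(l,i)\le r\}|$. Suppose that there are constants $l_0\ge 0$ and $\nu>0$ such that $$\sum_{k\in L}e^{-\mu\,\mathrm{dist}(i,k)}e^{-\mu\,\mathrm{dist}(k,j)}\le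 l_0\,e^{-\nu\,\mathrm{dist}(i,j)}\quad\text{for all } i,j\in L,\qquad \mu:=\frac1m\log\frac{\|V_xV_p\|}{\|V_xV_p\|-(\Delta E/2)^2}.$$ Let $T>0$. Then the Gibbs state $\varrho(T)=e^{-\hat H/T}/\mathrm{tr}[e^{-\hat H/T}]$ exists, and for all $i,j\in L$ with $\mathrm{dist}(i,j)\ge m$ the expectation values $\langle\hat x_i\hat x_j\rangle=\mathrm{tr}[\varrho(T)\hat x_i\hat x_j]$ and $\langle\hat p_i\hat p_j\rangle=\mathrm{tr}[\varrho(T)\hat p_i\hat p_j]$ exist and satisfy $$|\langle \hat x_i\hat x_j\rangle|\le K(T)\,\|V_p\|\,e^{-\mathrm{dist}(i,j)/\xi},\qquad |\langle \hat p_i\hat p_j\rangle|\le K(T)\,\|V_x\|\,e^{-\mathrm{dist}(i,j)/\xi},$$ where $$K(T):=\frac{\|V_xV_p\|^{1/2}\,v_{m/2}}{(\Delta E/2)^2}\left(1+\frac{4l_0\|V_xV_p\|/(\Delta E/2)^2}{\exp\Bigl(\frac{\Delta E}{T}\bigl(1-\frac{(\Delta E/2)^2}{4\|V_xV_p\|}\bigr)^{1/2}\Bigr)-1}\right),$$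 $$\xi:=\max\left\{\frac2\nu,\ \frac{2m}{\log\Bigl(\frac{\|V_xV_p\|}{\|V_xV_p\|-(\Delta E/2)^2}\Bigr)}\right\}.$$ If $\|V_xV_p\|=(\Delta E/2)^2$, the logarithm is read as $+\infty$: then $\mu=\infty$, $e^{-\mu\cdot 0}=1$, $e^{-\mu n}=0$ for $n\ge 1$, and $\xi=2/\nu$. -/

import Mathlib

open MeasureTheory
open scoped SchwartzMap LineDeriv Matrix

noncomputable section

namespace HarmonicLattice

/-! ### Canonical coordinates, Hamiltonian and Gibbs state in the Schrödinger representation -/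

section Quantum

variable {L : Type*} [Fintype L]

/-- Configuration space `ℝ^L`: one real coordinate for every lattice site. -/
abbrev Config (L : Type*) : Type _ := EuclideanSpace ℝ L

/-- The Hilbert space `L²(ℝ^L, ℂ)` of `|L|` bosonic degrees of freedom. -/
abbrev Hilb (L : Type*) [Fintype L] : Type _ :=
  Lp ℂ 2 (volume : Measure (Config L))

/-- The inclusion of the Schwartz space into `L²(ℝ^L)`. -/
def toHilb (L : Type*) [Fintype L] : 𝓢(Config L, ℂ) →L[ℂ] Hilb L :=
  SchwartzMap.toLpCLM ℂ ℂ 2 volume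

/-- The position operator `x̂ i` (multiplication by the `i`-th coordinate) on Schwartz functions. -/
def position (i : L) : 𝓢(Config L, ℂ) →L[ℂ] 𝓢(Config L, ℂ) :=
  SchwartzMap.smulLeftCLM ℂ (fun x : Config L => ((x i : ℝ) : ℂ))

/-- The momentum operator `p̂ i = -i ∂/∂x i` on Schwartz functions (units with `ℏ = 1`). -/
def momentum [DecidableEq L] (i : L) : 𝓢(Config L, ℂ) →L[ℂ] 𝓢(Config L, ℂ) :=
  (-Complex.I) •
    LineDeriv.lineDerivOpCLM ℂ 𝓢(Config L, ℂ) (EuclideanSpace.single i (1 : ℝ) : Config L)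

theorem position_apply (i : L) (f : 𝓢(Config L, ℂ)) (x : Config L) :
    position i f x = ((x i : ℝ) : ℂ) * f x := by
  have h : (fun x : Config L => ((x i : ℝ) : ℂ)).HasTemperateGrowth :=
    (Complex.ofRealCLM.comp (EuclideanSpace.proj i : Config L →L[ℝ] ℝ)).hasTemperateGrowth
  rw [position, SchwartzMap.smulLeftCLM_apply_apply h, smul_eq_mul]

theorem momentum_apply [DecidableEq L] (i : L) (f : 𝓢(Config L, ℂ)) (x : Config L) :
    momentum i f x = -Complex.I * lineDeriv ℝ f x (EuclideanSpace.single i (1 : ℝ)) := by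
  rw [← SchwartzMap.lineDerivOp_apply]
  rfl

/-- The quadratic Hamiltonian `p̂ᵀ V_p p̂ + x̂ᵀ V_x x̂` on Schwartz functions. -/
def hamiltonian [DecidableEq L] (Vx Vp : Matrix L L ℝ) : 𝓢(Config L, ℂ) →L[ℂ] 𝓢(Config L, ℂ) :=
  (∑ i, ∑ j, ((Vp i j : ℝ) : ℂ) • (momentum i ∘L momentum j)) +
    ∑ i, ∑ j, ((Vx i j : ℝ) : ℂ) • (position i ∘L position j)

/-- A complete orthonormal system of `L²(ℝ^L)` that consists of Schwartz functions.  (For a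
nonempty `L` every complete orthonormal system of `L²(ℝ^L)` is countably infinite.) -/
def IsSchwartzBasis (e : ℕ → 𝓢(Config L, ℂ)) : Prop :=
  Orthonormal ℂ (fun n => toHilb L (e n)) ∧
    (Submodule.span ℂ (Set.range fun n => toHilb L (e n))).topologicalClosure = ⊤

/-- `B = exp(-H/T)`, for an operator `H` with a complete orthonormal system of eigenvectors
`e n` (with eigenvalues `E n`): `B` is the bounded operator with `B e n = exp(-E n / T) e n`. -/
def IsBoltzmannOperator (H : 𝓢(Config L, ℂ) →L[ℂ] 𝓢(Config L, ℂ)) (T : ℝ)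
    (B : Hilb L →L[ℂ] Hilb L) : Prop :=
  ∃ (e : ℕ → 𝓢(Config L, ℂ)) (E : ℕ → ℝ), IsSchwartzBasis e ∧
    (∀ n, H (e n) = ((E n : ℝ) : ℂ) • e n) ∧
    ∀ n, B (toHilb L (e n)) = ((Real.exp (-E n / T) : ℝ) : ℂ) • toHilb L (e n)

/-- The operator `R`, defined on the Schwartz space, has trace `z`: in every complete orthonormal
system in its domain the sum of the diagonal matrix elements converges absolutely to `z`. -/
def HasTrace (R : 𝓢(Config L, ℂ) →L[ℂ] Hilb L) (z : ℂ) : Prop :=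
  ∀ e : ℕ → 𝓢(Config L, ℂ), IsSchwartzBasis e →
    HasSum (fun n => inner ℂ (toHilb L (e n)) (R (e n))) z

/-- `ρ` is the Gibbs state `exp(-H/T) / tr[exp(-H/T)]` of the Hamiltonian with couplings
`V_x`, `V_p` at temperature `T`. -/
def IsGibbsState [DecidableEq L] (Vx Vp : Matrix L L ℝ) (T : ℝ) (ρ : Hilb L →L[ℂ] Hilb L) : Prop :=
  ∃ (B : Hilb L →L[ℂ] Hilb L) (Z : ℂ), IsBoltzmannOperator (hamiltonian Vx Vp) T B ∧
    HasTrace (B ∘L toHilb L) Z ∧ Z ≠ 0 ∧ ρ = Z⁻¹ • B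

/-- The expectation value `⟨A⟩ = tr[ρ A]` exists and equals `z`. -/
def HasExpectation (ρ : Hilb L →L[ℂ] Hilb L) (A : 𝓢(Config L, ℂ) →L[ℂ] 𝓢(Config L, ℂ))
    (z : ℂ) : Prop :=
  HasTrace (ρ ∘L toHilb L ∘L A) z

end Quantum

/-! ### Couplings on a lattice -/

section Lattice

variable {L : Type*} [Fintype L] [DecidableEq L]

/-- Finite range `m`: `V i j = 0` whenever `dist(i,j) > m/2`. -/
def HasRange (G : SimpleGraph L) (m : ℕ) (V : Matrix L L ℝ) : Prop :=
  ∀ i j, (m : ℝ) / 2 < (G.dist i j : ℝ) → V i j = 0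

/-- `sup_i |B_r(i)|`, the maximal volume of a ball of radius `r` in the graph distance. -/
def ballVolume (G : SimpleGraph L) (r : ℝ) : ℕ :=
  Finset.univ.sup fun i => {l : L | (G.dist l i : ℝ) ≤ r}.ncard

/-- The operator norm of a real matrix acting on Euclidean space. -/
def opNorm (A : Matrix L L ℝ) : ℝ := ‖Matrix.toEuclideanCLM (n := L) (𝕜 := ℝ) A‖

/-- The smallest (real) eigenvalue. -/
def minEigenvalue (A : Matrix L L ℝ) : ℝ := sInf (spectrum ℝ A)

/-- `ΔE = 2 λ_min(V_x V_p)^{1/2}`. -/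
def gap (Vx Vp : Matrix L L ℝ) : ℝ := 2 * √(minEigenvalue (Vx * Vp))

/-- `log (‖V_x V_p‖ / (‖V_x V_p‖ - (ΔE/2)²))`. -/
def logRatio (Vx Vp : Matrix L L ℝ) : ℝ :=
  Real.log (opNorm (Vx * Vp) / (opNorm (Vx * Vp) - (gap Vx Vp / 2) ^ 2))

/-- `exp(-μ n)` with `μ = log (‖V_x V_p‖ / (‖V_x V_p‖ - (ΔE/2)²)) / m`.  If
`‖V_x V_p‖ = (ΔE/2)²` then `μ = ∞`, and the value is `1` for `n = 0` and `0` otherwise. -/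
def decayWeight (Vx Vp : Matrix L L ℝ) (m n : ℕ) : ℝ :=
  if opNorm (Vx * Vp) = (gap Vx Vp / 2) ^ 2 then (if n = 0 then 1 else 0)
  else Real.exp (-(logRatio Vx Vp / m * n))

/-- The convolution bound on the lattice, with constants `l₀` and `ν`. -/
def LatticeStructure (G : SimpleGraph L) (Vx Vp : Matrix L L ℝ) (m : ℕ) (l₀ ν : ℝ) : Prop :=
  ∀ i j, ∑ k, decayWeight Vx Vp m (G.dist i k) * decayWeight Vx Vp m (G.dist k j) ≤
    l₀ * Real.exp (-(ν * G.dist i j))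

/-- The prefactor `K(T)`. -/
def prefactor (G : SimpleGraph L) (Vx Vp : Matrix L L ℝ) (m : ℕ) (l₀ T : ℝ) : ℝ :=
  √(opNorm (Vx * Vp)) * ballVolume G (m / 2) / (gap Vx Vp / 2) ^ 2 *
    (1 + 4 * l₀ * opNorm (Vx * Vp) / (gap Vx Vp / 2) ^ 2 /
      (Real.exp (gap Vx Vp / T * √(1 - (gap Vx Vp / 2) ^ 2 / (4 * opNorm (Vx * Vp)))) - 1))

/-- The correlation length `ξ`.  (If `‖V_x V_p‖ = (ΔE/2)²` the logarithm is `∞` and the second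
entry is `0`; this is also the value it has here.) -/
def correlationLength (Vx Vp : Matrix L L ℝ) (m : ℕ) (ν : ℝ) : ℝ :=
  max (2 / ν) (2 * m / logRatio Vx Vp)

end Lattice

end HarmonicLattice

end

/-!
Let `u k` be a common orthonormal eigenbasis of the commuting couplings, with eigenvalues `a k` of
`V_x` and `b k` of `V_p` (`exists_joint_eigenbasis`).  In the directions `u k` the Hamiltonian is a
sum of independent oscillators of frequencies `ω k = √(a k * b k)`, and everything about the Gibbs
state can be computed.

*The Gibbs state.*  Ladder operators on the Schwartz space (`LadderSystem`, `NormalModes.system`)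
create occupation-number states, indexed by multisets of modes, from a Gaussian ground state.  They
are eigenvectors of the Hamiltonian (`hamiltonian_state`), orthonormal by the commutation relations,
and complete (`NormalModes.span_normState_dense`): a square integrable function orthogonal to all of
them has vanishing moments against the Gaussian, so the Fourier transform of its product with the
Gaussian is zero.  A symmetric operator with such a basis has only one Boltzmann operator, because
eigenvectors with different eigenvalues are orthogonal; hence the Gibbs state exists and is unique
(`isGibbsState_iff`).  Traces may be evaluated in any complete orthonormal system of Schwartz
functions by Fubini's theorem (`hasSum_inner_diagonal`), and the sums over occupation numbers give
`⟨x i x j⟩ = ½ ∑ k, u k i * u k j * b k * coth (ω k / T) / ω k`, and the same with `a k` for the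
momenta (`hasExpectation_position`, `hasExpectation_momentum`).

*Decay.*  As a function of `λ = ω ^ 2`, `coth (ω / T) / ω` is the sum
`T * ∑ r : ℤ, 1 / (λ + (π T r) ^ 2)` of resolvents with positive weights (`hasSum_thermal`).
Expand every resolvent of `V_x V_p` in a Neumann series around `N = ‖V_x V_p‖`.  The terms of low
order are matrix elements of powers of a banded matrix, and vanish between distant sites.  In the
remainder after `n₀` terms, each `λ` lies between the squared half gap `g` and `N`, so it is at most
`(1 - g / N) ^ n₀` times the value of the resolvent at `g`.  Resummation gives the bound
`(1 - g / N) ^ n₀ * coth (√g / T) / √g` (`abs_sum_thermal_le`), with `n₀ ≥ dist(i,j) / (2 m)`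
because `dist(i,j) ≥ m` (`abs_correlation_le`).  This is the second of the two rates in the
correlation length.  The bound on the convolution of exponentials on the lattice enters only at
coinciding sites, where it says `1 ≤ l₀`; this is what makes `K(T)` at least `coth (√g / T) / √g`
(`thermal_le_prefactor`).
-/

noncomputable section

namespace HarmonicLattice

/-! ### The thermal function and its decay -/

/-- The function `ω ↦ coth(ω/T)/ω`, written through the Bose occupation number of a mode with level
spacing `2ω`. -/
def thermal (T ω : ℝ) : ℝ := 1 / ω * (1 + 2 / (Real.exp (2 * ω / T) - 1))

/-- Partial fractions of the hyperbolic cotangent, from those of the cotangent at imaginary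
argument; the value of the sum is `coth y - 1 / y`. -/
theorem coth_partial_fractions {y : ℝ} (hy : 0 < y) :
    HasSum (fun n : ℕ => 2 * y / (y ^ 2 + (Real.pi * (n + 1)) ^ 2))
      (1 + 2 / (Real.exp (2 * y) - 1) - 1 / y) := by
  have hyc : (y : ℂ) ≠ 0 := by exact_mod_cast hy.ne'
  set x : ℂ := Complex.I * y / Real.pi with hx
  have hxi : x.im = y / Real.pi := by
    have : x = ((y / Real.pi : ℝ) : ℂ) * Complex.I := by rw [hx]; push_cast; ring
    rw [this, Complex.im_ofReal_mul, Complex.I_im, mul_one]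
  have hz : x ∈ Complex.integerComplement := by
    rw [Complex.mem_integerComplement_iff]
    rintro ⟨n, hn⟩
    have := congrArg Complex.im hn
    rw [hxi] at this
    have h2 : 0 < y / Real.pi := by positivity
    rw [Complex.intCast_im] at this
    linarith
  have h := (summable_cotTerm hz).hasSum
  have h1 := cot_series_rep' hz
  have h2 : ∑' n, cotTerm x n = Real.pi * Complex.cot (Real.pi * x) - 1 / x := by
    rw [h1]
  rw [h2] at h
  have h3 := h.mul_left (Complex.I / Real.pi)
  have hE : (Complex.exp (2 * y) - 1) ≠ 0 := by
    have : (1 : ℝ) < Real.exp (2 * y) := Real.one_lt_exp_iff.2 (by linarith)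
    have h4 : (Real.exp (2 * y) - 1 : ℝ) ≠ 0 := by linarith
    exact_mod_cast h4
  have hcot : Complex.I / Real.pi * (Real.pi * Complex.cot (Real.pi * x) - 1 / x) =
      ((1 + 2 / (Real.exp (2 * y) - 1) - 1 / y : ℝ) : ℂ) := by
    have hpx : (Real.pi : ℂ) * x = Complex.I * y := by rw [hx]; field_simp
    have hc : Complex.cot (Complex.I * y) = -Complex.I * (1 + 2 / (Complex.exp (2 * y) - 1)) := by
      rw [Complex.cot_eq_exp_ratio]
      have e : 2 * Complex.I * (Complex.I * y) = -(2 * y) := by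
        linear_combination (2 * y : ℂ) * Complex.I_mul_I
      rw [e, Complex.exp_neg]
      have hE0 := Complex.exp_ne_zero (2 * y)
      have hE' : 1 - (Complex.exp (2 * y))⁻¹ ≠ 0 := by
        intro h0
        apply hE
        have : (Complex.exp (2 * y))⁻¹ = 1 := by linear_combination -h0
        rw [inv_eq_one] at this
        rw [this]; ring
      rw [div_eq_iff (mul_ne_zero Complex.I_ne_zero hE')]
      field_simp
      ring_nf
      simp only [Complex.I_sq]
      ring
    rw [hpx, hc, hx]
    push_cast
    field_simp
    ring_nf
    simp only [Complex.I_sq]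
    ring
  rw [hcot] at h3
  rw [← Complex.hasSum_ofReal]
  refine h3.congr_fun fun n => ?_
  rw [cotTerm_identity hz]
  have e : (x + (n + 1)) * (x - (n + 1)) =
      -((y ^ 2 + (Real.pi * (n + 1)) ^ 2 : ℝ) : ℂ) / Real.pi ^ 2 := by
    rw [hx]; push_cast; field_simp; ring_nf; simp only [Complex.I_sq]; ring
  have hpos : (((y ^ 2 + (Real.pi * (n + 1)) ^ 2 : ℝ)) : ℂ) ≠ 0 := by
    have : (0 : ℝ) < y ^ 2 + (Real.pi * (n + 1)) ^ 2 := by positivity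
    exact_mod_cast this.ne'
  rw [e, hx, Complex.ofReal_div]
  field_simp
  push_cast
  ring_nf
  simp only [Complex.I_sq]
  ring

/-- Mittag-Leffler expansion (Matsubara sum): as a function of `ω ^ 2`, `coth(ω/T)/ω` is a positive
superposition of resolvents. -/
theorem hasSum_thermal {T ω : ℝ} (hT : 0 < T) (hω : 0 < ω) :
    HasSum (fun r : ℕ => (if r = 0 then T else 2 * T) / (ω ^ 2 + (Real.pi * T * r) ^ 2))
      (thermal T ω) := by
  have h := (coth_partial_fractions (y := ω / T) (by positivity)).mul_left (1 / ω)
  rw [← hasSum_nat_add_iff' 1]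
  have e : 2 * (ω / T) = 2 * ω / T := by ring
  have hE : Real.exp (2 * ω / T) - 1 ≠ 0 := by
    have : (1 : ℝ) < Real.exp (2 * ω / T) := Real.one_lt_exp_iff.2 (by positivity)
    linarith
  have hv : thermal T ω - ∑ i ∈ Finset.range 1,
      (if i = 0 then T else 2 * T) / (ω ^ 2 + (Real.pi * T * (i : ℕ)) ^ 2) =
      1 / ω * (1 + 2 / (Real.exp (2 * (ω / T)) - 1) - 1 / (ω / T)) := by
    rw [e]
    simp [thermal]
    field_simp
  rw [hv]
  refine h.congr_fun fun r => ?_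
  have : (0 : ℝ) < (ω / T) ^ 2 + (Real.pi * (r + 1)) ^ 2 := by positivity
  have : (0 : ℝ) < ω ^ 2 + (Real.pi * T * (r + 1)) ^ 2 := by positivity
  rw [if_neg (by omega)]
  push_cast
  field_simp

theorem thermal_pos {T ω : ℝ} (hT : 0 < T) (hω : 0 < ω) : 0 < thermal T ω := by
  have : (1 : ℝ) < Real.exp (2 * ω / T) := Real.one_lt_exp_iff.2 (by positivity)
  have : 0 < Real.exp (2 * ω / T) - 1 := by linarith
  unfold thermal
  positivity

/-- Neumann series of the resolvent `1 / (l + s)` around `l = N`, with remainder. -/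
theorem resolvent_expansion {N s l : ℝ} (hN : N + s ≠ 0) (hl : l + s ≠ 0) (n : ℕ) :
    1 / (l + s) = ∑ k ∈ Finset.range n, (N - l) ^ k / (N + s) ^ (k + 1) +
      ((N - l) / (N + s)) ^ n / (l + s) := by
  induction n with
  | zero => simp
  | succ n ih =>
    rw [Finset.sum_range_succ, ih, add_assoc]
    congr 1
    rw [div_pow, div_pow]
    field_simp
    ring

/-- If the moments `∑ p_k (N - λ_k)^n` vanish for `n < n₀`, then the resolvent sum is governed by
the remainder of the Neumann series around `N`. -/
theorem abs_sum_resolvent_le {κ : Type*} [Fintype κ] {p l : κ → ℝ} {C N g s : ℝ} {n₀ : ℕ}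
    (hg : 0 < g) (hs : 0 ≤ s) (hl : ∀ k, g ≤ l k) (hlN : ∀ k, l k ≤ N)
    (hgN : g ≤ N) (hp : ∑ k, |p k| ≤ C)
    (hmom : ∀ n < n₀, ∑ k, p k * (N - l k) ^ n = 0) :
    |∑ k, p k / (l k + s)| ≤ C * (1 - g / N) ^ n₀ / (g + s) := by
  have hN : 0 < N := hg.trans_le hgN
  have hq : 0 ≤ 1 - g / N := by rw [sub_nonneg, div_le_one hN]; exact hgN
  have e : ∑ k, p k / (l k + s) = ∑ k, p k * (((N - l k) / (N + s)) ^ n₀ / (l k + s)) := by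
    have : ∀ k, p k / (l k + s) = ∑ n ∈ Finset.range n₀, p k * (N - l k) ^ n / (N + s) ^ (n + 1) +
        p k * (((N - l k) / (N + s)) ^ n₀ / (l k + s)) := by
      intro k
      have h1 := resolvent_expansion (N := N) (s := s) (l := l k) (by positivity)
        (by have := hl k; linarith) n₀
      rw [div_eq_mul_one_div, h1, mul_add, Finset.mul_sum]
      simp [mul_div_assoc]
    rw [Finset.sum_congr rfl fun k _ => this k, Finset.sum_add_distrib, Finset.sum_comm]
    rw [Finset.sum_eq_zero, zero_add]
    intro n hn
    rw [← Finset.sum_div, hmom n (Finset.mem_range.1 hn), zero_div]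
  rw [e]
  calc |∑ k, p k * (((N - l k) / (N + s)) ^ n₀ / (l k + s))|
      ≤ ∑ k, |p k * (((N - l k) / (N + s)) ^ n₀ / (l k + s))| := Finset.abs_sum_le_sum_abs _ _
    _ ≤ ∑ k, |p k| * ((1 - g / N) ^ n₀ / (g + s)) := by
        refine Finset.sum_le_sum fun k _ => ?_
        rw [abs_mul]
        have h1 := hl k
        have h2 := hlN k
        have h0 : 0 ≤ (N - l k) / (N + s) := div_nonneg (by linarith) (by linarith)
        have h3 : (N - l k) / (N + s) ≤ 1 - g / N := by
          rw [div_le_iff₀ (by linarith)]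
          have : (1 - g / N) * N = N - g := by field_simp
          nlinarith
        have h4 : 0 < l k + s := by linarith
        rw [abs_of_nonneg (div_nonneg (pow_nonneg h0 _) h4.le)]
        gcongr
    _ = (∑ k, |p k|) * ((1 - g / N) ^ n₀ / (g + s)) := by rw [Finset.sum_mul]
    _ ≤ C * ((1 - g / N) ^ n₀ / (g + s)) := by
        gcongr
    _ = _ := by ring

/-- The bound for resolvents, summed over the Matsubara series: vanishing of the first `n₀` moments
leaves the factor `(1 - g / N) ^ n₀` times the thermal function at the lower bound `g`. -/
theorem abs_sum_thermal_le {κ : Type*} [Fintype κ] {p l : κ → ℝ} {C N g T : ℝ} {n₀ : ℕ}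
    (hg : 0 < g) (hT : 0 < T) (hl : ∀ k, g ≤ l k) (hlN : ∀ k, l k ≤ N)
    (hgN : g ≤ N) (hp : ∑ k, |p k| ≤ C)
    (hmom : ∀ n < n₀, ∑ k, p k * (N - l k) ^ n = 0) :
    |∑ k, p k * thermal T (√(l k))| ≤ C * (1 - g / N) ^ n₀ * thermal T (√g) := by
  have hsum : HasSum (fun r : ℕ => ∑ k, p k * ((if r = 0 then T else 2 * T) /
      (l k + (Real.pi * T * r) ^ 2))) (∑ k, p k * thermal T (√(l k))) := by
    refine hasSum_sum fun k _ => ?_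
    have hk : 0 < l k := hg.trans_le (hl k)
    have := hasSum_thermal hT (Real.sqrt_pos.2 hk)
    rw [Real.sq_sqrt hk.le] at this
    exact this.mul_left _
  have hsum2 := (hasSum_thermal hT (Real.sqrt_pos.2 hg)).mul_left (C * (1 - g / N) ^ n₀)
  rw [Real.sq_sqrt hg.le] at hsum2
  rw [← Real.norm_eq_abs]
  refine hsum.norm_le_of_bounded hsum2 fun r => ?_
  have hc : 0 ≤ (if r = 0 then T else 2 * T) := by split_ifs <;> linarith
  have := abs_sum_resolvent_le hg (sq_nonneg (Real.pi * T * r)) hl hlN hgN hp hmom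
  have e : ∑ k, p k * ((if r = 0 then T else 2 * T) / (l k + (Real.pi * T * r) ^ 2)) =
      (if r = 0 then T else 2 * T) * ∑ k, p k / (l k + (Real.pi * T * r) ^ 2) := by
    rw [Finset.mul_sum]
    refine Finset.sum_congr rfl fun k _ => ?_
    ring
  rw [e, Real.norm_eq_abs, abs_mul, abs_of_nonneg hc]
  calc _ ≤ (if r = 0 then T else 2 * T) *
        (C * (1 - g / N) ^ n₀ / (g + (Real.pi * T * r) ^ 2)) := by gcongr
    _ = _ := by ring

/-! ### Joint diagonalisation of the couplings -/

section Lattice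

variable {L : Type*} [Fintype L] [DecidableEq L]

/-- Two commuting symmetric matrices have a common orthonormal eigenbasis. -/
theorem exists_joint_eigenbasis {V W : Matrix L L ℝ} (hV : V.IsHermitian) (hW : W.IsHermitian)
    (h : Commute V W) :
    ∃ (u : OrthonormalBasis L ℝ (EuclideanSpace ℝ L)) (a b : L → ℝ),
      (∀ k, V *ᵥ (u k).ofLp = a k • (u k).ofLp) ∧ ∀ k, W *ᵥ (u k).ofLp = b k • (u k).ofLp := by
  classical
  have hA : (Matrix.toEuclideanLin V).IsSymmetric := Matrix.isSymmetric_toEuclideanLin_iff.2 hV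
  have hB : (Matrix.toEuclideanLin W).IsSymmetric := Matrix.isSymmetric_toEuclideanLin_iff.2 hW
  have hAB : Commute (Matrix.toEuclideanLin V) (Matrix.toEuclideanLin W) := by
    ext x : 1
    have : V *ᵥ W *ᵥ x.ofLp = W *ᵥ V *ᵥ x.ofLp := by
      rw [Matrix.mulVec_mulVec, Matrix.mulVec_mulVec, h.eq]
    simp [Matrix.toEuclideanLin, Matrix.toLpLin_apply, this]
  have hint := LinearMap.IsSymmetric.directSum_isInternal_of_commute hA hB hAB
  have hof := LinearMap.IsSymmetric.orthogonalFamily_eigenspace_inf_eigenspace hA hB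
  -- the joint eigenspaces are indexed by all of `ℝ × ℝ`; only finitely many are nonzero
  have hfin := Submodule.finite_ne_bot_of_iSupIndep hint.submodule_iSupIndep
  have hint' := DirectSum.isInternal_ne_bot_iff.2 hint
  have hof' := hof.comp (Subtype.val_injective (p := fun i : ℝ × ℝ =>
    Module.End.eigenspace (Matrix.toEuclideanLin V) i.2 ⊓
      Module.End.eigenspace (Matrix.toEuclideanLin W) i.1 ≠ ⊥))
  have hn : Module.finrank ℝ (EuclideanSpace ℝ L) = Fintype.card L := finrank_euclideanSpace
  have : Fintype {i : ℝ × ℝ // Module.End.eigenspace (Matrix.toEuclideanLin V) i.2 ⊓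
      Module.End.eigenspace (Matrix.toEuclideanLin W) i.1 ≠ ⊥} := hfin.fintype
  let e := Fintype.equivFin L
  let v := hint'.subordinateOrthonormalBasis hn hof'
  have hv : ∀ k, ∃ i : ℝ × ℝ, v k ∈ Module.End.eigenspace (Matrix.toEuclideanLin V) i.2 ⊓
      Module.End.eigenspace (Matrix.toEuclideanLin W) i.1 := fun k =>
    ⟨_, hint'.subordinateOrthonormalBasis_subordinate hn k hof'⟩
  choose i hi using hv
  refine ⟨v.reindex e.symm, fun k => (i (e k)).2, fun k => (i (e k)).1, fun k => ?_, fun k => ?_⟩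
  · have := Module.End.mem_eigenspace_iff.1 (hi (e k)).1
    have := congrArg WithLp.ofLp this
    simpa [Matrix.toEuclideanLin, Matrix.toLpLin_apply] using this
  · have := Module.End.mem_eigenspace_iff.1 (hi (e k)).2
    have := congrArg WithLp.ofLp this
    simpa [Matrix.toEuclideanLin, Matrix.toLpLin_apply] using this

end Lattice

/-! ### Matrices in an eigenbasis -/

section Eigenbasis

variable {L : Type*} [Fintype L] [DecidableEq L] (u : OrthonormalBasis L ℝ (EuclideanSpace ℝ L))

theorem eigenbasis_complete (i j : L) : ∑ k, u k i * u k j = if i = j then 1 else 0 := by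
  have := u.sum_inner_mul_inner (EuclideanSpace.single i 1) (EuclideanSpace.single j 1)
  simpa [EuclideanSpace.inner_single_left, EuclideanSpace.inner_single_right, Pi.single_apply,
    eq_comm] using this

theorem eigenbasis_orthonormal (k l : L) : ∑ i, u k i * u l i = if k = l then 1 else 0 := by
  have := orthonormal_iff_ite.1 u.orthonormal k l
  rw [PiLp.inner_apply] at this
  simpa [mul_comm] using this

variable {u}

theorem entry_eq_sum {M : Matrix L L ℝ} {c : L → ℝ}
    (h : ∀ k, M *ᵥ (u k).ofLp = c k • (u k).ofLp) (i j : L) :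
    M i j = ∑ k, u k i * u k j * c k := by
  have h1 : ∀ k, u k i * u k j * c k = ∑ l, M i l * (u k l * u k j) := by
    intro k
    have := congrFun (h k) i
    simp only [Matrix.mulVec, dotProduct, Pi.smul_apply, smul_eq_mul] at this
    rw [mul_right_comm, mul_comm (u k i), ← this, Finset.sum_mul]
    simp only [mul_assoc]
  rw [Finset.sum_congr rfl fun k _ => h1 k, Finset.sum_comm]
  simp_rw [← Finset.mul_sum, eigenbasis_complete]
  simp

/-- The weights `u k i * u k j` of the eigenvalues have total mass at most one, since both
`∑ k, u k i ^ 2` and `∑ k, u k j ^ 2` are one. -/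
theorem sum_abs_weights_le (i j : L) {c : L → ℝ} {C : ℝ} (hc : ∀ k, |c k| ≤ C) :
    ∑ k, |u k i * u k j * c k| ≤ C := by
  have hC : 0 ≤ C := (abs_nonneg _).trans (hc i)
  calc ∑ k, |u k i * u k j * c k| ≤ ∑ k, (u k i * u k i + u k j * u k j) / 2 * C := by
        refine Finset.sum_le_sum fun k _ => ?_
        rw [abs_mul]
        refine mul_le_mul ?_ (hc k) (abs_nonneg _) ?_
        · rw [abs_le]
          constructor <;> nlinarith [sq_nonneg (u k i + u k j), sq_nonneg (u k i - u k j)]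
        · nlinarith [sq_nonneg (u k i), sq_nonneg (u k j)]
    _ = C := by
        rw [← Finset.sum_mul, ← Finset.sum_div, Finset.sum_add_distrib, eigenbasis_complete,
          eigenbasis_complete]
        simp

theorem abs_eigenvalue_le_opNorm {M : Matrix L L ℝ} {c : L → ℝ}
    (h : ∀ k, M *ᵥ (u k).ofLp = c k • (u k).ofLp) (k : L) : |c k| ≤ opNorm M := by
  have h1 : Matrix.toEuclideanCLM (n := L) (𝕜 := ℝ) M (u k) = c k • u k := by
    have := h k
    ext i
    simpa using congrFun this i
  have h2 := (Matrix.toEuclideanCLM (n := L) (𝕜 := ℝ) M).le_opNorm (u k)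
  rw [h1, norm_smul, u.orthonormal.1 k] at h2
  simpa [opNorm] using h2

theorem spectrum_eq_range {M : Matrix L L ℝ} {c : L → ℝ}
    (h : ∀ k, M *ᵥ (u k).ofLp = c k • (u k).ofLp) : spectrum ℝ M = Set.range c := by
  rw [← Matrix.spectrum_toLin']
  ext x
  rw [← Module.End.hasEigenvalue_iff_mem_spectrum]
  constructor
  · intro hx
    obtain ⟨v, hv, hv0⟩ := hx.exists_hasEigenvector
    by_contra hne
    apply hv0
    have hv := Module.End.mem_eigenspace_iff.1 hv
    rw [Matrix.toLin'_apply] at hv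
    -- every coefficient of `v` in the eigenbasis vanishes
    have hco : ∀ k, ∑ j, u k j * v j = 0 := by
      intro k
      have h1 : ∑ i, u k i * (M *ᵥ v) i = x * ∑ i, u k i * v i := by
        rw [hv, Finset.mul_sum]
        exact Finset.sum_congr rfl fun i _ => by simp; ring
      have h2 : ∑ i, u k i * (M *ᵥ v) i = c k * ∑ i, u k i * v i := by
        simp only [Matrix.mulVec, dotProduct, Finset.mul_sum]
        rw [Finset.sum_comm]
        refine Finset.sum_congr rfl fun j _ => ?_
        have h3 : ∑ i, u k i * M i j = c k * u k j := by
          simp_rw [entry_eq_sum h, Finset.mul_sum]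
          rw [Finset.sum_comm]
          have : ∀ l, ∑ i, u k i * (u l i * u l j * c l) =
              (∑ i, u k i * u l i) * (u l j * c l) := fun l => by
            rw [Finset.sum_mul]; exact Finset.sum_congr rfl fun i _ => by ring
          simp_rw [this, eigenbasis_orthonormal]
          simp [mul_comm]
        simp_rw [← mul_assoc]
        rw [← Finset.sum_mul, h3]
      have h4 : (x - c k) * ∑ i, u k i * v i = 0 := by rw [sub_mul, ← h1, ← h2, sub_self]
      rcases mul_eq_zero.1 h4 with h5 | h5
      · exact absurd ⟨k, by linarith⟩ hne
      · exact h5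
    have hz : WithLp.toLp 2 v = (0 : EuclideanSpace ℝ L) := by
      rw [← u.sum_repr' (WithLp.toLp 2 v)]
      refine Finset.sum_eq_zero fun k _ => ?_
      have h1 : inner ℝ (u k) (WithLp.toLp 2 v) = 0 := by
        rw [PiLp.inner_apply, ← hco k]
        exact Finset.sum_congr rfl fun i _ => by simp [mul_comm]
      rw [h1, zero_smul]
    simpa using congrArg WithLp.ofLp hz
  · rintro ⟨k, rfl⟩
    refine Module.End.hasEigenvalue_of_hasEigenvector (x := (u k).ofLp) ⟨?_, ?_⟩
    · rw [Module.End.mem_eigenspace_iff, Matrix.toLin'_apply, h k]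
    · intro h0
      have : u k = 0 := by ext i; simpa using congrFun h0 i
      exact u.orthonormal.ne_zero k this

end Eigenbasis

/-! ### Banded matrices -/

section Range

variable {L : Type*}

/-- Band width `r`: entries at graph distance larger than `r` vanish. -/
def IsBanded (G : SimpleGraph L) (r : ℝ) (V : Matrix L L ℝ) : Prop :=
  ∀ i j, r < (G.dist i j : ℝ) → V i j = 0

variable {G : SimpleGraph L} {r s : ℝ} {V W : Matrix L L ℝ}

theorem IsBanded.mul [Fintype L] (hG : G.Connected) (hV : IsBanded G r V) (hW : IsBanded G s W) :
    IsBanded G (r + s) (V * W) := by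
  intro i j hij
  rw [Matrix.mul_apply]
  refine Finset.sum_eq_zero fun k _ => ?_
  have h : (G.dist i j : ℝ) ≤ G.dist i k + G.dist k j := by exact_mod_cast hG.dist_triangle
  by_cases h1 : r < G.dist i k
  · rw [hV i k h1, zero_mul]
  · rw [hW k j (by linarith), mul_zero]

theorem IsBanded.mono (hV : IsBanded G r V) (h : r ≤ s) : IsBanded G s V :=
  fun i j hij => hV i j (h.trans_lt hij)

theorem isBanded_scalar_sub [DecidableEq L] (hV : IsBanded G r V) (hr : 0 ≤ r) (c : ℝ) :
    IsBanded G r (c • (1 : Matrix L L ℝ) - V) := by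
  intro i j hij
  have hne : i ≠ j := by
    rintro rfl
    simp at hij
    linarith
  simp [hV i j hij, Matrix.one_apply_ne hne]

theorem IsBanded.pow [Fintype L] [DecidableEq L] (hG : G.Connected) (hV : IsBanded G r V) (n : ℕ) :
    IsBanded G (n * r) (V ^ n) := by
  induction n with
  | zero =>
    intro i j hij
    have hne : i ≠ j := by
      rintro rfl
      simp at hij
    simp [Matrix.one_apply_ne hne]
  | succ n ih =>
    rw [pow_succ]
    exact (ih.mul hG hV).mono (by push_cast; linarith)

end Range

/-! ### Decay of the thermal correlations -/

section Decay

variable {L : Type*} [Fintype L] [DecidableEq L] {u : OrthonormalBasis L ℝ (EuclideanSpace ℝ L)}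
  {Vx Vp : Matrix L L ℝ} {a b : L → ℝ}

theorem mul_mulVec_eigenvector {L : Type*} [Fintype L] {V W : Matrix L L ℝ} {v : L → ℝ} {x y : ℝ}
    (hV : V *ᵥ v = x • v) (hW : W *ᵥ v = y • v) : (V * W) *ᵥ v = (x * y) • v := by
  rw [← Matrix.mulVec_mulVec, hW, Matrix.mulVec_smul, hV, smul_smul, mul_comm]

theorem pow_mulVec_eigenvector {V : Matrix L L ℝ} {v : L → ℝ} {x : ℝ} (hV : V *ᵥ v = x • v)
    (n : ℕ) : (V ^ n) *ᵥ v = (x ^ n) • v := by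
  induction n with
  | zero => simp
  | succ n ih => rw [pow_succ, pow_succ, mul_mulVec_eigenvector ih hV]

theorem eigenvalue_pos {V : Matrix L L ℝ} (hV : V.PosDef) {c : L → ℝ}
    (h : ∀ k, V *ᵥ (u k).ofLp = c k • (u k).ofLp) (k : L) : 0 < c k := by
  have hne : (u k).ofLp ≠ 0 := by
    intro h0
    have : u k = 0 := by ext i; simpa using congrFun h0 i
    exact u.orthonormal.ne_zero k this
  have := hV.dotProduct_mulVec_pos hne
  rw [h k, dotProduct_smul, star_trivial] at this
  have h1 : (u k).ofLp ⬝ᵥ (u k).ofLp = 1 := by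
    have := eigenbasis_orthonormal u k k
    simpa [dotProduct] using this
  rw [h1] at this
  simpa using this

/-- The squared half gap is a positive lower bound of the eigenvalues of `V_x V_p`, so that the
square roots in `gap` are not those of a negative number. -/
theorem half_gap_sq [Nonempty L] (ha : ∀ k, Vx *ᵥ (u k).ofLp = a k • (u k).ofLp)
    (hb : ∀ k, Vp *ᵥ (u k).ofLp = b k • (u k).ofLp) (ha0 : ∀ k, 0 < a k) (hb0 : ∀ k, 0 < b k) :
    0 < (gap Vx Vp / 2) ^ 2 ∧ (∀ k, (gap Vx Vp / 2) ^ 2 ≤ a k * b k) ∧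
      √((gap Vx Vp / 2) ^ 2) = gap Vx Vp / 2 := by
  have hs := spectrum_eq_range (u := u) (M := Vx * Vp) (c := fun k => a k * b k)
    fun k => mul_mulVec_eigenvector (ha k) (hb k)
  have hfin : (Set.range fun k => a k * b k).Finite := Set.finite_range _
  have hmem : minEigenvalue (Vx * Vp) ∈ Set.range fun k => a k * b k := by
    rw [minEigenvalue, hs]
    exact (Set.range_nonempty _).csInf_mem hfin
  obtain ⟨k₀, hk₀⟩ := hmem
  have hpos : 0 < minEigenvalue (Vx * Vp) := by
    rw [← hk₀]; exact mul_pos (ha0 k₀) (hb0 k₀)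
  have e : gap Vx Vp / 2 = √(minEigenvalue (Vx * Vp)) := by rw [gap]; ring
  rw [e, Real.sq_sqrt hpos.le]
  refine ⟨hpos, fun k => ?_, rfl⟩
  rw [minEigenvalue, hs]
  exact csInf_le hfin.bddBelow ⟨k, rfl⟩

/-- The lattice condition at coinciding sites: the term `k = i` of the sum is already one. -/
theorem one_le_of_latticeStructure [Nonempty L] {G : SimpleGraph L} {m : ℕ} {l₀ ν : ℝ}
    (h : LatticeStructure G Vx Vp m l₀ ν) : 1 ≤ l₀ := by
  have i : L := Classical.arbitrary L
  have h0 : decayWeight Vx Vp m (G.dist i i) = 1 := by simp [decayWeight]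
  have hnn : ∀ n, 0 ≤ decayWeight Vx Vp m n := by
    intro n
    unfold decayWeight
    split_ifs <;> positivity
  have h1 := h i i
  simp only [SimpleGraph.dist_self, Nat.cast_zero, mul_zero, neg_zero, Real.exp_zero,
    mul_one] at h1
  refine le_trans ?_ h1
  have h2 := Finset.single_le_sum
    (f := fun k => decayWeight Vx Vp m (G.dist i k) * decayWeight Vx Vp m (G.dist k i))
    (fun k _ => mul_nonneg (hnn _) (hnn _)) (Finset.mem_univ i)
  rwa [h0, mul_one] at h2

theorem one_le_ballVolume {L : Type*} [Fintype L] [Nonempty L] (G : SimpleGraph L) {r : ℝ}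
    (hr : 0 ≤ r) : 1 ≤ ballVolume G r := by
  have i : L := Classical.arbitrary L
  have h1 : 1 ≤ {l : L | (G.dist l i : ℝ) ≤ r}.ncard := by
    rw [Nat.one_le_iff_ne_zero, Ne, Set.ncard_eq_zero]
    exact Set.Nonempty.ne_empty ⟨i, by simpa using hr⟩
  exact h1.trans (Finset.le_sup (f := fun i => {l : L | (G.dist l i : ℝ) ≤ r}.ncard)
    (Finset.mem_univ i))

/-- The prefactor dominates the thermal function at the bottom of the spectrum. -/
theorem thermal_le_prefactor [Nonempty L] {G : SimpleGraph L} {m : ℕ} {l₀ ν T : ℝ}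
    (hlat : LatticeStructure G Vx Vp m l₀ ν) (hT : 0 < T) (hgap : 0 < gap Vx Vp)
    (hN : (gap Vx Vp / 2) ^ 2 ≤ opNorm (Vx * Vp)) :
    thermal T (gap Vx Vp / 2) ≤ prefactor G Vx Vp m l₀ T := by
  have hl := one_le_of_latticeStructure hlat
  have hv : (1 : ℝ) ≤ ballVolume G (m / 2) := by
    exact_mod_cast one_le_ballVolume G (by positivity)
  unfold thermal prefactor
  set D := gap Vx Vp with hD
  set N := opNorm (Vx * Vp) with hNd
  set v : ℝ := (ballVolume G (m / 2) : ℝ) with hvd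
  have hD2 : 0 < (D / 2) ^ 2 := by positivity
  have hNpos : 0 < N := hD2.trans_le hN
  have hsN : D / 2 ≤ √N := by
    rw [← Real.sqrt_sq (by positivity : 0 ≤ D / 2)]
    exact Real.sqrt_le_sqrt hN
  have h1 : 1 / (D / 2) ≤ √N * v / (D / 2) ^ 2 := by
    rw [div_le_div_iff₀ (by positivity) hD2]
    nlinarith [Real.sqrt_nonneg N, mul_le_mul hsN hv zero_le_one (Real.sqrt_nonneg N)]
  have hsq : 0 < √(1 - (D / 2) ^ 2 / (4 * N)) := by
    apply Real.sqrt_pos.2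
    have : (D / 2) ^ 2 / (4 * N) ≤ 1 / 4 := by
      rw [div_le_div_iff₀ (by positivity) (by norm_num)]; linarith
    linarith
  have hsq1 : √(1 - (D / 2) ^ 2 / (4 * N)) ≤ 1 := by
    rw [Real.sqrt_le_iff]
    have : 0 ≤ (D / 2) ^ 2 / (4 * N) := by positivity
    exact ⟨zero_le_one, by linarith⟩
  have hden : 0 < Real.exp (D / T * √(1 - (D / 2) ^ 2 / (4 * N))) - 1 := by
    have : (1 : ℝ) < Real.exp (D / T * √(1 - (D / 2) ^ 2 / (4 * N))) :=
      Real.one_lt_exp_iff.2 (by positivity)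
    linarith
  have hle : Real.exp (D / T * √(1 - (D / 2) ^ 2 / (4 * N))) ≤ Real.exp (2 * (D / 2) / T) := by
    apply Real.exp_le_exp.2
    calc D / T * √(1 - (D / 2) ^ 2 / (4 * N)) ≤ D / T * 1 := by gcongr
      _ = 2 * (D / 2) / T := by ring
  have h2 : 2 ≤ 4 * l₀ * N / (D / 2) ^ 2 := by
    rw [le_div_iff₀ hD2]
    nlinarith
  have h3 : 2 / (Real.exp (2 * (D / 2) / T) - 1) ≤ 4 * l₀ * N / (D / 2) ^ 2 /
      (Real.exp (D / T * √(1 - (D / 2) ^ 2 / (4 * N))) - 1) := by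
    gcongr
  have h4 : 0 ≤ 2 / (Real.exp (2 * (D / 2) / T) - 1) :=
    div_nonneg zero_le_two (by linarith)
  gcongr

/-- Exponential decay of the thermal correlations, for either of the couplings `V`: only the
remainder of the Neumann series after `⌈dist(i,j)/m - 1/2⌉` terms contributes. -/
theorem abs_correlation_le [Nonempty L] {G : SimpleGraph L} (hG : G.Connected)
    (ha : ∀ k, Vx *ᵥ (u k).ofLp = a k • (u k).ofLp)
    (hb : ∀ k, Vp *ᵥ (u k).ofLp = b k • (u k).ofLp) (ha0 : ∀ k, 0 < a k) (hb0 : ∀ k, 0 < b k)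
    {m : ℕ} (hm : 1 ≤ m) (hrx : HasRange G m Vx) (hrp : HasRange G m Vp)
    {l₀ ν T : ℝ} (hlat : LatticeStructure G Vx Vp m l₀ ν) (hT : 0 < T)
    {V : Matrix L L ℝ} {c : L → ℝ} (hV : HasRange G m V)
    (hc : ∀ k, V *ᵥ (u k).ofLp = c k • (u k).ofLp) {i j : L} (hij : m ≤ G.dist i j) :
    |∑ k, u k i * u k j * c k * thermal T (√(a k * b k))| ≤
      prefactor G Vx Vp m l₀ T * opNorm V *
        Real.exp (-(G.dist i j / correlationLength Vx Vp m ν)) := by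
  obtain ⟨hg, hgl, hsqrt⟩ := half_gap_sq ha hb ha0 hb0
  have hgap : 0 < gap Vx Vp := by
    have h1 : 0 ≤ gap Vx Vp := by unfold gap; positivity
    rcases h1.lt_or_eq with h | h
    · exact h
    · rw [← h] at hg; simp at hg
  have hlN : ∀ k, a k * b k ≤ opNorm (Vx * Vp) := fun k => (le_abs_self _).trans
    (abs_eigenvalue_le_opNorm (u := u) (c := fun k => a k * b k)
      (fun k => mul_mulVec_eigenvector (ha k) (hb k)) k)
  have i₀ : L := Classical.arbitrary L
  have hgN : (gap Vx Vp / 2) ^ 2 ≤ opNorm (Vx * Vp) := (hgl i₀).trans (hlN i₀)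
  have hpre := thermal_le_prefactor hlat hT hgap hgN
  have hth := thermal_pos hT (show 0 < gap Vx Vp / 2 by positivity)
  have hm0 : (0 : ℝ) < m := by exact_mod_cast hm
  have hmd : (m : ℝ) ≤ G.dist i j := by exact_mod_cast hij
  set N := opNorm (Vx * Vp) with hNd
  set g := (gap Vx Vp / 2) ^ 2 with hgd
  set d : ℝ := (G.dist i j : ℝ) with hd
  have hN : 0 < N := hg.trans_le hgN
  -- `V (N - V_x V_p) ^ n` has band width `m / 2 + n m`, which is below `d` exactly for `n < n₀`
  set n₀ : ℕ := ⌈d / m - 1 / 2⌉₊ with hn₀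
  have hmom : ∀ n < n₀, ∑ k, u k i * u k j * c k * (N - a k * b k) ^ n = 0 := by
    intro n hn
    have hband : IsBanded G (m / 2 + n * (m / 2 + m / 2))
        (V * (N • (1 : Matrix L L ℝ) - Vx * Vp) ^ n) := by
      refine IsBanded.mul hG hV (IsBanded.pow hG ?_ n)
      exact isBanded_scalar_sub (IsBanded.mul hG hrx hrp) (by positivity) N
    have heig : ∀ k, (V * (N • (1 : Matrix L L ℝ) - Vx * Vp) ^ n) *ᵥ (u k).ofLp =
        (c k * (N - a k * b k) ^ n) • (u k).ofLp := by
      intro k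
      refine mul_mulVec_eigenvector (hc k) (pow_mulVec_eigenvector ?_ n)
      rw [Matrix.sub_mulVec, Matrix.smul_mulVec, Matrix.one_mulVec,
        mul_mulVec_eigenvector (ha k) (hb k), sub_smul]
    have h0 := hband i j ?_
    · rw [entry_eq_sum heig] at h0
      simpa [mul_assoc] using h0
    · have h1 := Nat.lt_ceil.1 hn
      have h2 : ((n : ℝ) + 1 / 2) < d / m := by linarith
      rw [lt_div_iff₀ hm0] at h2
      linarith
  have hmain := abs_sum_thermal_le (p := fun k => u k i * u k j * c k) (l := fun k => a k * b k)
    hg hT hgl hlN hgN (sum_abs_weights_le i j (abs_eigenvalue_le_opNorm hc)) hmom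
  rw [hsqrt] at hmain
  refine hmain.trans ?_
  have hVn : 0 ≤ opNorm V := norm_nonneg _
  -- comparison of the two decay rates
  have hrate : (1 - g / N) ^ n₀ ≤ Real.exp (-(d / correlationLength Vx Vp m ν)) := by
    have hn₀d : d / m - 1 / 2 ≤ n₀ := Nat.le_ceil _
    have hdm : 1 ≤ d / m := by rwa [one_le_div hm0]
    rcases hgN.eq_or_lt with h | h
    -- `logRatio` has a junk value here, but the left side is `0 ^ n₀` with `n₀ ≠ 0`
    · have : 1 - g / N = 0 := by rw [h, div_self hN.ne', sub_self]
      rw [this, zero_pow]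
      · positivity
      · rintro h0
        rw [h0] at hn₀d
        push_cast at hn₀d
        linarith
    · have hq : 0 < 1 - g / N := by rw [sub_pos, div_lt_one hN]; exact h
      have hlog : logRatio Vx Vp = -Real.log (1 - g / N) := by
        have e : 1 - g / N = (N - g) / N := by field_simp
        rw [logRatio, ← Real.log_inv, e, inv_div]
      have hlpos : 0 < logRatio Vx Vp := by
        rw [hlog, neg_pos]
        refine Real.log_neg hq ?_
        have : 0 < g / N := by positivity
        linarith
      have hξ : 2 * m / logRatio Vx Vp ≤ correlationLength Vx Vp m ν := le_max_right _ _
      have h1 : d / correlationLength Vx Vp m ν ≤ d / (2 * m / logRatio Vx Vp) := by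
        gcongr
      have h2 : d / (2 * m / logRatio Vx Vp) = d / m / 2 * logRatio Vx Vp := by
        field_simp
      -- `d / m - 1 / 2 ≥ d / m / 2` because `d ≥ m`
      have h3 : d / m / 2 * logRatio Vx Vp ≤ n₀ * logRatio Vx Vp := by
        gcongr
        linarith
      have h4 : (1 - g / N) ^ n₀ = Real.exp (-(n₀ * logRatio Vx Vp)) := by
        rw [hlog, mul_neg, neg_neg, Real.exp_nat_mul, Real.exp_log hq]
      rw [h4]
      apply Real.exp_le_exp.2
      linarith
  have hq0 : 0 ≤ (1 - g / N) ^ n₀ := by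
    apply pow_nonneg
    rw [sub_nonneg, div_le_one hN]
    exact hgN
  calc opNorm V * (1 - g / N) ^ n₀ * thermal T (gap Vx Vp / 2)
      = thermal T (gap Vx Vp / 2) * opNorm V * (1 - g / N) ^ n₀ := by ring
    _ ≤ _ := by
        have := hth.le.trans hpre
        gcongr

end Decay

/-! ### Ladder operators and occupation-number states -/

/-- Creation and annihilation operators for modes `ι` on a space `V` of vectors of a Hilbert space
`H` (in the application `V` is the Schwartz space), with a vacuum vector. -/
structure LadderSystem (ι V H : Type*) [DecidableEq ι] [AddCommGroup V] [Module ℂ V]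
    [NormedAddCommGroup H] [InnerProductSpace ℂ H] where
  /-- the embedding into the Hilbert space -/
  emb : V →ₗ[ℂ] H
  /-- annihilation operators -/
  ann : ι → V →ₗ[ℂ] V
  /-- creation operators -/
  cre : ι → V →ₗ[ℂ] V
  /-- the vacuum -/
  vac : V
  cre_comm : ∀ k l f, cre k (cre l f) = cre l (cre k f)
  ann_cre : ∀ k l f, ann k (cre l f) = cre l (ann k f) + if k = l then f else 0
  inner_cre : ∀ k f g, inner ℂ (emb (cre k f)) (emb g) = inner ℂ (emb f) (emb (ann k g))
  ann_vac : ∀ k, ann k vac = 0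
  emb_vac : emb vac ≠ 0

namespace LadderSystem

variable {ι V H : Type*} [DecidableEq ι] [AddCommGroup V] [Module ℂ V]
    [NormedAddCommGroup H] [InnerProductSpace ℂ H] (S : LadderSystem ι V H)

/-- The (unnormalised) occupation-number state: the creation operators of the multiset `s` applied
to the vacuum. -/
def state (s : Multiset ι) : V :=
  haveI : LeftCommutative fun (l : ι) (f : V) => S.cre l f := ⟨S.cre_comm⟩
  s.foldr (fun l f => S.cre l f) S.vac

@[simp] theorem state_zero : S.state 0 = S.vac := rfl

theorem state_cons (k : ι) (s : Multiset ι) : S.state (k ::ₘ s) = S.cre k (S.state s) := by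
  have : LeftCommutative fun (l : ι) (f : V) => S.cre l f := ⟨S.cre_comm⟩
  exact Multiset.foldr_cons (fun l f => S.cre l f) S.vac k s

/-- Annihilation by the mode `k` removes one quantum; `s.count k` is its occupation number. -/
theorem ann_state (k : ι) (s : Multiset ι) :
    S.ann k (S.state s) = (s.count k : ℂ) • S.state (s.erase k) := by
  induction s using Multiset.induction_on with
  | empty => simp [S.ann_vac]
  | cons l s ih =>
    rw [state_cons, S.ann_cre, ih, map_smul, ← state_cons]
    by_cases h : k = l
    · subst h
      by_cases hk : k ∈ s
      · rw [Multiset.cons_erase hk, if_pos rfl, Multiset.count_cons_self, Multiset.erase_cons_head]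
        push_cast
        rw [add_smul, one_smul]
      · simp [Multiset.count_eq_zero_of_notMem hk]
    · rw [if_neg h, add_zero, Multiset.count_cons_of_ne h,
        Multiset.erase_cons_tail _ (Ne.symm h)]

theorem cre_ann_state (k : ι) (s : Multiset ι) :
    S.cre k (S.ann k (S.state s)) = (s.count k : ℂ) • S.state s := by
  rw [ann_state, map_smul, ← state_cons]
  by_cases hk : k ∈ s
  · rw [Multiset.cons_erase hk]
  · simp [Multiset.count_eq_zero_of_notMem hk]

theorem inner_state_of_ne {s t : Multiset ι} (h : s ≠ t) :
    inner ℂ (S.emb (S.state s)) (S.emb (S.state t)) = 0 := by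
  induction s using Multiset.induction_on generalizing t with
  | empty =>
    obtain ⟨k, hk⟩ := Multiset.exists_mem_of_ne_zero h.symm
    obtain ⟨t, rfl⟩ := Multiset.exists_cons_of_mem hk
    rw [state_cons, ← inner_conj_symm, S.inner_cre, state_zero, S.ann_vac]
    simp
  | cons k s ih =>
    rw [state_cons, S.inner_cre, ann_state, map_smul, inner_smul_right]
    by_cases hk : k ∈ t
    · rw [ih, mul_zero]
      rintro rfl
      exact h (Multiset.cons_erase hk)
    · simp [Multiset.count_eq_zero_of_notMem hk]

theorem inner_self_eq_ofReal (x : H) : inner ℂ x x = ((‖x‖ ^ 2 : ℝ) : ℂ) := by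
  rw [inner_self_eq_norm_sq_to_K]; norm_cast

theorem norm_sq_cre_state (k : ι) (s : Multiset ι) :
    ‖S.emb (S.cre k (S.state s))‖ ^ 2 = (s.count k + 1) * ‖S.emb (S.state s)‖ ^ 2 := by
  have h : inner ℂ (S.emb (S.cre k (S.state s))) (S.emb (S.cre k (S.state s))) =
      ((s.count k : ℂ) + 1) * inner ℂ (S.emb (S.state s)) (S.emb (S.state s)) := by
    rw [S.inner_cre, ← state_cons, ann_state, Multiset.count_cons_self, Multiset.erase_cons_head,
      map_smul, inner_smul_right]
    push_cast
    rfl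
  rw [inner_self_eq_ofReal, inner_self_eq_ofReal] at h
  exact_mod_cast h

theorem norm_sq_ann_state (k : ι) (s : Multiset ι) :
    ‖S.emb (S.ann k (S.state s))‖ ^ 2 = s.count k * ‖S.emb (S.state s)‖ ^ 2 := by
  have h : inner ℂ (S.emb (S.ann k (S.state s))) (S.emb (S.ann k (S.state s))) =
      (s.count k : ℂ) * inner ℂ (S.emb (S.state s)) (S.emb (S.state s)) := by
    rw [← S.inner_cre, cre_ann_state, map_smul, inner_smul_left]
    simp
  rw [inner_self_eq_ofReal, inner_self_eq_ofReal] at h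
  exact_mod_cast h

theorem emb_state_ne_zero (s : Multiset ι) : S.emb (S.state s) ≠ 0 := by
  induction s using Multiset.induction_on with
  | empty => exact S.emb_vac
  | cons k s ih =>
    rw [state_cons]
    intro h0
    have h := S.norm_sq_cre_state k s
    rw [h0, norm_zero] at h
    have h1 : 0 < ‖S.emb (S.state s)‖ := norm_pos_iff.2 ih
    have : (0 : ℝ) < (s.count k + 1) * ‖S.emb (S.state s)‖ ^ 2 := by positivity
    rw [← h] at this
    simp at this

/-- The normalised occupation-number state. -/
def normState (s : Multiset ι) : V := ((‖S.emb (S.state s)‖⁻¹ : ℝ) : ℂ) • S.state s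

theorem orthonormal_normState : Orthonormal ℂ fun s => S.emb (S.normState s) := by
  constructor
  · intro s
    have := norm_ne_zero_iff.2 (S.emb_state_ne_zero s)
    simp only [normState]
    rw [map_smul, norm_smul, Complex.norm_real, norm_inv, norm_norm, inv_mul_cancel₀ this]
  · intro s t h
    show inner ℂ (S.emb (S.normState s)) (S.emb (S.normState t)) = 0
    rw [normState, normState, map_smul, map_smul, inner_smul_left, inner_smul_right,
      S.inner_state_of_ne h, mul_zero, mul_zero]

/-! ### Quadratic expressions in the ladder operators -/

/-- A linear combination of ladder operators. -/
def field [Fintype ι] (c d : ι → ℂ) : V →ₗ[ℂ] V := ∑ k, (c k • S.ann k + d k • S.cre k)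

theorem field_apply [Fintype ι] (c d : ι → ℂ) (f : V) :
    S.field c d f = ∑ k, (c k • S.ann k f + d k • S.cre k f) := by
  simp [field]

theorem field_field_apply [Fintype ι] (c d c' d' : ι → ℂ) (f : V) :
    S.field c d (S.field c' d' f) = ∑ k, ∑ l,
      ((c k * c' l) • S.ann k (S.ann l f) + (c k * d' l) • S.ann k (S.cre l f) +
      ((d k * c' l) • S.cre k (S.ann l f) + (d k * d' l) • S.cre k (S.cre l f))) := by
  rw [field_apply]
  refine Finset.sum_congr rfl fun k _ => ?_
  rw [field_apply, map_sum, map_sum, Finset.smul_sum, Finset.smul_sum, ← Finset.sum_add_distrib]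
  refine Finset.sum_congr rfl fun l _ => ?_
  simp only [map_add, map_smul, smul_add, smul_smul]

/-- A ladder operator maps an occupation-number state to a multiple of another one, and its norm
there grows like the square root of the total occupation number. -/
theorem exists_state_of_ladder {D : V →ₗ[ℂ] V} {k : ι} (hD : D = S.ann k ∨ D = S.cre k)
    (s : Multiset ι) : ‖S.emb (D (S.state s))‖ ≤ √(s.card + 1) * ‖S.emb (S.state s)‖ ∧
      ∃ (c : ℂ) (t : Multiset ι), D (S.state s) = c • S.state t ∧ t.card ≤ s.card + 1 := by
  have hc : (s.count k : ℝ) ≤ s.card := by exact_mod_cast Multiset.count_le_card k s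
  have key : ∀ x : V, ∀ n : ℝ, n ≤ s.card + 1 →
      ‖S.emb x‖ ^ 2 = n * ‖S.emb (S.state s)‖ ^ 2 →
      ‖S.emb x‖ ≤ √(s.card + 1) * ‖S.emb (S.state s)‖ := by
    intro x n hn h
    refine abs_le_of_sq_le_sq' ?_ (by positivity) |>.2
    rw [mul_pow, Real.sq_sqrt (by positivity), h]
    gcongr
  rcases hD with rfl | rfl
  · exact ⟨key _ _ (by linarith) (S.norm_sq_ann_state k s), _, _, S.ann_state k s,
      (Multiset.card_le_card (Multiset.erase_le k s)).trans (Nat.le_succ _)⟩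
  · exact ⟨key _ _ (by linarith) (S.norm_sq_cre_state k s), 1, k ::ₘ s,
      by rw [one_smul, state_cons], by simp⟩

theorem norm_ladder_ladder_le {D D' : V →ₗ[ℂ] V} {k l : ι} (hD : D = S.ann k ∨ D = S.cre k)
    (hD' : D' = S.ann l ∨ D' = S.cre l) (s : Multiset ι) :
    ‖S.emb (D (D' (S.state s)))‖ ≤ (s.card + 2) * ‖S.emb (S.state s)‖ := by
  obtain ⟨h1, c, t, hc, ht⟩ := S.exists_state_of_ladder hD' s
  have h2 : ‖S.emb (D (D' (S.state s)))‖ ≤ √(t.card + 1) * ‖S.emb (D' (S.state s))‖ := by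
    rw [hc]
    simp only [map_smul, norm_smul]
    have := (S.exists_state_of_ladder hD t).1
    calc _ ≤ ‖c‖ * (√(t.card + 1) * ‖S.emb (S.state t)‖) := by gcongr
      _ = _ := by ring
  have ht' : (t.card : ℝ) ≤ s.card + 1 := by exact_mod_cast ht
  calc _ ≤ √(t.card + 1) * (√(s.card + 1) * ‖S.emb (S.state s)‖) := h2.trans (by gcongr)
    _ ≤ √(s.card + 2) * (√(s.card + 2) * ‖S.emb (S.state s)‖) := by
        have h3 : (t.card : ℝ) + 1 ≤ s.card + 2 := by linarith
        have h4 : (s.card : ℝ) + 1 ≤ s.card + 2 := by linarith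
        gcongr
    _ = _ := by rw [← mul_assoc, Real.mul_self_sqrt (by positivity)]

/-- A product of two fields is unbounded, but grows only linearly in the total occupation number;
Boltzmann weights make up for this. -/
theorem norm_field_field_le [Fintype ι] (c d c' d' : ι → ℂ) :
    ∃ C : ℝ, ∀ s, ‖S.emb (S.field c d (S.field c' d' (S.normState s)))‖ ≤ C * (s.card + 2) := by
  refine ⟨∑ k, ∑ l, (‖c k‖ + ‖d k‖) * (‖c' l‖ + ‖d' l‖), fun s => ?_⟩
  have hpos := norm_pos_iff.2 (S.emb_state_ne_zero s)
  suffices h : ‖S.emb (S.field c d (S.field c' d' (S.state s)))‖ ≤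
      (∑ k, ∑ l, (‖c k‖ + ‖d k‖) * (‖c' l‖ + ‖d' l‖)) *
        ((s.card + 2) * ‖S.emb (S.state s)‖) by
    rw [normState]
    simp only [map_smul, norm_smul, Complex.norm_real, norm_inv, norm_norm]
    rw [inv_mul_le_iff₀ hpos]
    linarith
  rw [field_field_apply, map_sum, Finset.sum_mul]
  refine (norm_sum_le _ _).trans (Finset.sum_le_sum fun k _ => ?_)
  rw [map_sum, Finset.sum_mul]
  refine (norm_sum_le _ _).trans (Finset.sum_le_sum fun l _ => ?_)
  simp only [map_add, map_smul]
  refine (norm_add_le _ _).trans ((add_le_add (norm_add_le _ _) (norm_add_le _ _)).trans ?_)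
  simp only [norm_smul, norm_mul]
  have h1 := S.norm_ladder_ladder_le (Or.inl (rfl : S.ann k = S.ann k))
    (Or.inl (rfl : S.ann l = S.ann l)) s
  have h2 := S.norm_ladder_ladder_le (Or.inl (rfl : S.ann k = S.ann k))
    (Or.inr (rfl : S.cre l = S.cre l)) s
  have h3 := S.norm_ladder_ladder_le (Or.inr (rfl : S.cre k = S.cre k))
    (Or.inl (rfl : S.ann l = S.ann l)) s
  have h4 := S.norm_ladder_ladder_le (Or.inr (rfl : S.cre k = S.cre k))
    (Or.inr (rfl : S.cre l = S.cre l)) s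
  calc _ ≤ ‖c k‖ * ‖c' l‖ * ((s.card + 2) * ‖S.emb (S.state s)‖) +
        ‖c k‖ * ‖d' l‖ * ((s.card + 2) * ‖S.emb (S.state s)‖) +
        (‖d k‖ * ‖c' l‖ * ((s.card + 2) * ‖S.emb (S.state s)‖) +
        ‖d k‖ * ‖d' l‖ * ((s.card + 2) * ‖S.emb (S.state s)‖)) := by gcongr
    _ = _ := by ring

/-- The expectation value of a product of two fields in an occupation-number state: only the terms
that restore all occupation numbers contribute. -/
theorem inner_field_field [Fintype ι] (c d c' d' : ι → ℂ) (s : Multiset ι) :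
    inner ℂ (S.emb (S.normState s)) (S.emb (S.field c d (S.field c' d' (S.normState s)))) =
      ∑ k, (c k * d' k * (s.count k + 1) + d k * c' k * s.count k) := by
  have hpos := norm_pos_iff.2 (S.emb_state_ne_zero s)
  have haa : ∀ k l, inner ℂ (S.emb (S.state s)) (S.emb (S.ann k (S.ann l (S.state s)))) = 0 := by
    intro k l
    rw [ann_state, map_smul, ann_state, smul_smul, map_smul, inner_smul_right]
    by_cases hl : l ∈ s
    · rw [S.inner_state_of_ne, mul_zero]
      intro h
      have h1 := congrArg Multiset.card h
      have h2 := Multiset.card_le_card (Multiset.erase_le k (s.erase l))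
      have h3 := Multiset.card_erase_lt_of_mem hl
      omega
    · simp [Multiset.count_eq_zero_of_notMem hl]
  have hcc : ∀ k l, inner ℂ (S.emb (S.state s)) (S.emb (S.cre k (S.cre l (S.state s)))) = 0 := by
    intro k l
    rw [← state_cons, ← state_cons, S.inner_state_of_ne]
    intro h
    have h1 := congrArg Multiset.card h
    simp at h1
    omega
  have hca : ∀ k l, inner ℂ (S.emb (S.state s)) (S.emb (S.cre k (S.ann l (S.state s)))) =
      if k = l then (s.count k : ℂ) * inner ℂ (S.emb (S.state s)) (S.emb (S.state s)) else 0 := by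
    intro k l
    split_ifs with h
    · subst h
      rw [cre_ann_state, map_smul, inner_smul_right]
    · rw [ann_state, map_smul, map_smul, inner_smul_right, ← state_cons]
      by_cases hl : l ∈ s
      · rw [S.inner_state_of_ne, mul_zero]
        intro h'
        have h1 := congrArg (Multiset.count l) h'
        rw [Multiset.count_cons_of_ne (Ne.symm h), Multiset.count_erase_self] at h1
        have := Multiset.count_pos.2 hl
        omega
      · simp [Multiset.count_eq_zero_of_notMem hl]
  have hac : ∀ k l, inner ℂ (S.emb (S.state s)) (S.emb (S.ann k (S.cre l (S.state s)))) =
      if k = l then ((s.count k : ℂ) + 1) * inner ℂ (S.emb (S.state s)) (S.emb (S.state s))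
      else 0 := by
    intro k l
    rw [S.ann_cre, map_add, inner_add_right, hca]
    by_cases h : k = l
    · subst h
      simp [add_mul]
    · simp [h, Ne.symm h]
  have hz : inner ℂ (S.emb (S.state s)) (S.emb (S.state s)) =
      ((‖S.emb (S.state s)‖ ^ 2 : ℝ) : ℂ) := by
    exact inner_self_eq_ofReal _
  have e : inner ℂ (S.emb (S.state s)) (S.emb (S.field c d (S.field c' d' (S.state s)))) =
      (∑ k, (c k * d' k * (s.count k + 1) + d k * c' k * s.count k)) *
        ((‖S.emb (S.state s)‖ ^ 2 : ℝ) : ℂ) := by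
    rw [field_field_apply, map_sum, inner_sum, Finset.sum_mul]
    refine Finset.sum_congr rfl fun k _ => ?_
    rw [map_sum, inner_sum, Finset.sum_eq_single k]
    · simp only [map_add, map_smul, inner_add_right, inner_smul_right, haa, hcc, hca, hac, if_true,
        hz]
      ring
    · intro l _ hl
      simp only [map_add, map_smul, inner_add_right, inner_smul_right, haa, hcc, hca, hac,
        if_neg (Ne.symm hl), mul_zero, add_zero]
    · simp
  rw [normState]
  simp only [map_smul, inner_smul_left, inner_smul_right]
  rw [e, Complex.conj_ofReal]
  push_cast
  have : (‖S.emb (S.state s)‖ : ℂ) ≠ 0 := by exact_mod_cast hpos.ne'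
  field_simp

end LadderSystem

/-! ### Sums over occupation numbers -/

section Sums

variable {ι : Type*} [DecidableEq ι] [Fintype ι]

theorem multiset_prod_map_eq (x : ι → ℝ) (s : Multiset ι) :
    (s.map x).prod = ∏ k, x k ^ s.count k := by
  induction s using Multiset.induction_on with
  | empty => simp
  | cons l s ih =>
    rw [Multiset.map_cons, Multiset.prod_cons, ih]
    simp only [Multiset.count_cons, pow_add, Finset.prod_mul_distrib, pow_ite, pow_one, pow_zero]
    rw [Finset.prod_ite_eq']
    simp [mul_comm]

/-- The partition function converges: it is bounded by a product of geometric series. -/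
theorem summable_multiset_prod {x : ι → ℝ} (h0 : ∀ k, 0 ≤ x k) (h1 : ∀ k, x k < 1) :
    Summable fun s : Multiset ι => (s.map x).prod := by
  have hpi : Summable fun n : ι → ℕ => ∏ k, x k ^ n k := by
    refine summable_of_sum_le (c := ∏ k, (1 - x k)⁻¹)
      (fun n => Finset.prod_nonneg fun k _ => pow_nonneg (h0 k) _) fun F => ?_
    let t : ι → Finset ℕ := fun k => F.image fun n => n k
    have hsub : F ⊆ Fintype.piFinset t := fun n hn => by
      rw [Fintype.mem_piFinset]
      exact fun k => Finset.mem_image_of_mem _ hn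
    calc ∑ n ∈ F, ∏ k, x k ^ n k ≤ ∑ n ∈ Fintype.piFinset t, ∏ k, x k ^ n k :=
          Finset.sum_le_sum_of_subset_of_nonneg hsub
            fun n _ _ => Finset.prod_nonneg fun k _ => pow_nonneg (h0 k) _
      _ = ∏ k, ∑ j ∈ t k, x k ^ j := (Finset.prod_univ_sum t fun k j => x k ^ j).symm
      _ ≤ ∏ k, (1 - x k)⁻¹ := by
          refine Finset.prod_le_prod
            (fun k _ => Finset.sum_nonneg fun j _ => pow_nonneg (h0 k) _) fun k _ => ?_
          rw [← tsum_geometric_of_lt_one (h0 k) (h1 k)]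
          exact (summable_geometric_of_lt_one (h0 k) (h1 k)).sum_le_tsum _
            fun j _ => pow_nonneg (h0 k) _
  have hinj : Function.Injective fun (s : Multiset ι) (k : ι) => s.count k :=
    fun s t h => Multiset.ext.2 fun k => congrFun h k
  refine (hpi.comp_injective hinj).congr fun s => ?_
  rw [multiset_prod_map_eq]
  rfl

theorem summable_card_mul_multiset_prod {x : ι → ℝ} (h0 : ∀ k, 0 < x k) (h1 : ∀ k, x k < 1) :
    Summable fun s : Multiset ι => ((s.card : ℝ) + 2) * (s.map x).prod := by
  -- half of the decay absorbs the polynomial factor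
  obtain ⟨r, hr0, hr1, hr⟩ : ∃ r : ℝ, 0 < r ∧ r < 1 ∧ ∀ k, √(x k) ≤ r := by
    rcases isEmpty_or_nonempty ι with h | h
    · exact ⟨1 / 2, by norm_num, by norm_num, fun k => h.elim k⟩
    · obtain ⟨k₀, hk₀⟩ := Finite.exists_max fun k => √(x k)
      refine ⟨√(x k₀), Real.sqrt_pos.2 (h0 _), ?_, hk₀⟩
      rw [← Real.sqrt_one]
      exact Real.sqrt_lt_sqrt (h0 _).le (h1 _)
  have hb : Summable fun n : ℕ => ((n : ℝ) + 2) * r ^ n := by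
    have e1 := summable_pow_mul_geometric_of_norm_lt_one 1 (r := r)
      (by rwa [Real.norm_of_nonneg hr0.le])
    have e2 := (summable_geometric_of_lt_one hr0.le hr1).mul_left 2
    refine (e1.add e2).congr fun n => by ring
  set C := ∑' n : ℕ, ((n : ℝ) + 2) * r ^ n with hC
  have hsq := summable_multiset_prod (x := fun k => √(x k)) (fun k => Real.sqrt_nonneg _)
    fun k => by rw [← Real.sqrt_one]; exact Real.sqrt_lt_sqrt (h0 _).le (h1 _)
  have hprod : ∀ s : Multiset ι, 0 ≤ (s.map fun k => √(x k)).prod := fun s =>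
    Multiset.prod_nonneg fun y hy => by
      obtain ⟨k, _, rfl⟩ := Multiset.mem_map.1 hy; positivity
  have hle : ∀ s : Multiset ι, (s.map fun k => √(x k)).prod ≤ r ^ s.card := by
    intro s
    induction s using Multiset.induction_on with
    | empty => simp
    | cons l s ih =>
      rw [Multiset.map_cons, Multiset.prod_cons, Multiset.card_cons, pow_succ']
      exact mul_le_mul (hr l) ih (hprod s) hr0.le
  refine Summable.of_nonneg_of_le (fun s => ?_) (fun s => ?_) (hsq.mul_left C)
  · refine mul_nonneg (by positivity) (Multiset.prod_nonneg fun y hy => ?_)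
    obtain ⟨k, _, rfl⟩ := Multiset.mem_map.1 hy
    exact (h0 k).le
  · have e : (s.map x).prod = (s.map fun k => √(x k)).prod * (s.map fun k => √(x k)).prod := by
      rw [← Multiset.prod_map_mul]
      congr 1
      exact Multiset.map_congr rfl fun k _ => (Real.mul_self_sqrt (h0 k).le).symm
    rw [e, ← mul_assoc]
    refine mul_le_mul_of_nonneg_right ?_ (hprod s)
    refine (mul_le_mul_of_nonneg_left (hle s) (by positivity)).trans ?_
    exact hb.le_tsum s.card fun n _ => by positivity

/-- Bose-Einstein statistics: the mean occupation number of the mode `k`, by the shift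
`s ↦ k ::ₘ s` of the occupation numbers. -/
theorem hasSum_count_mul_multiset_prod {x : ι → ℝ} (h0 : ∀ k, 0 < x k) (h1 : ∀ k, x k < 1)
    (k : ι) : HasSum (fun s : Multiset ι => (s.count k : ℝ) * (s.map x).prod)
      (x k / (1 - x k) * ∑' s : Multiset ι, (s.map x).prod) := by
  have hp : ∀ s : Multiset ι, 0 ≤ (s.map x).prod := fun s =>
    Multiset.prod_nonneg fun y hy => by
      obtain ⟨k, _, rfl⟩ := Multiset.mem_map.1 hy; exact (h0 k).le
  have hZ := summable_multiset_prod (fun k => (h0 k).le) h1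
  have hS : Summable fun s : Multiset ι => (s.count k : ℝ) * (s.map x).prod := by
    refine Summable.of_nonneg_of_le (fun s => mul_nonneg (by positivity) (hp s)) (fun s => ?_)
      (summable_card_mul_multiset_prod h0 h1)
    refine mul_le_mul_of_nonneg_right ?_ (hp s)
    have : (s.count k : ℝ) ≤ s.card := by exact_mod_cast Multiset.count_le_card k s
    linarith
  have hinj : Function.Injective fun s : Multiset ι => k ::ₘ s := fun s t h =>
    (Multiset.cons_inj_right k).1 h
  have hshift : ∑' s : Multiset ι, (s.count k : ℝ) * (s.map x).prod =
      ∑' s : Multiset ι, ((k ::ₘ s).count k : ℝ) * ((k ::ₘ s).map x).prod := by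
    refine (hinj.tsum_eq (f := fun s : Multiset ι => (s.count k : ℝ) * (s.map x).prod) ?_).symm
    intro s hs
    have hk : k ∈ s := by
      by_contra h
      apply hs
      simp [Multiset.count_eq_zero_of_notMem h]
    exact ⟨s.erase k, Multiset.cons_erase hk⟩
  have hrec : ∑' s : Multiset ι, (s.count k : ℝ) * (s.map x).prod =
      x k * (∑' s : Multiset ι, (s.count k : ℝ) * (s.map x).prod +
        ∑' s : Multiset ι, (s.map x).prod) := by
    conv_lhs => rw [hshift]
    rw [← hS.tsum_add hZ, ← tsum_mul_left]
    refine tsum_congr fun s => ?_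
    rw [Multiset.count_cons_self, Multiset.map_cons, Multiset.prod_cons]
    push_cast
    ring
  convert hS.hasSum using 1
  have : 1 - x k ≠ 0 := by have := h1 k; linarith
  field_simp
  linarith

end Sums

/-! ### Diagonal operators and their traces -/

section Trace

variable {σ H : Type*} [NormedAddCommGroup H] [InnerProductSpace ℂ H] [CompleteSpace H]

/-- The operator `∑ s, w s |φ s⟩⟨φ s|`, a sum in operator norm; it is used for orthonormal `φ` and
summable `w`. -/
def diagonal (φ : σ → H) (w : σ → ℝ) : H →L[ℂ] H :=
  ∑' s, ((w s : ℝ) : ℂ) • (innerSL ℂ (φ s)).smulRight (φ s)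

variable {φ : σ → H} {w : σ → ℝ}

theorem hasSum_diagonal (hφ : Orthonormal ℂ φ) (hw : ∀ s, 0 ≤ w s) (hs : Summable w) (x : H) :
    HasSum (fun s => ((w s : ℝ) : ℂ) • inner ℂ (φ s) x • φ s) (diagonal φ w x) := by
  have h : Summable fun s => ((w s : ℝ) : ℂ) • (innerSL ℂ (φ s)).smulRight (φ s) := by
    refine Summable.of_norm_bounded hs fun s => ?_
    rw [norm_smul, ContinuousLinearMap.norm_smulRight_apply, innerSL_apply_norm, hφ.1 s,
      Complex.norm_real, Real.norm_of_nonneg (hw s)]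
    simp
  have := h.hasSum.mapL (ContinuousLinearMap.apply ℂ H x)
  simpa [diagonal] using this

theorem diagonal_apply_self (hφ : Orthonormal ℂ φ) (hw : ∀ s, 0 ≤ w s) (hs : Summable w) (t : σ) :
    diagonal φ w (φ t) = ((w t : ℝ) : ℂ) • φ t := by
  classical
  refine (hasSum_diagonal hφ hw hs (φ t)).unique ?_
  have := hasSum_single (f := fun s => ((w s : ℝ) : ℂ) • inner ℂ (φ s) (φ t) • φ s) t
    fun s hst => by simp [hφ.2 hst]
  simpa [inner_self_eq_norm_sq_to_K, hφ.1 t] using this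

/-- The trace of `diagonal φ w ∘ A`, evaluated in an arbitrary complete orthonormal system `e`.
The vectors `ψ n` and `χ s` stand for `A (e n)` and `A† (φ s)`; `A` itself may be unbounded. -/
theorem hasSum_inner_diagonal (hφ : Orthonormal ℂ φ) (hw : ∀ s, 0 ≤ w s) (hs : Summable w)
    {e ψ : ℕ → H} (he : Orthonormal ℂ e)
    (hd : (Submodule.span ℂ (Set.range e)).topologicalClosure = ⊤) {χ : σ → H}
    (hadj : ∀ n s, inner ℂ (φ s) (ψ n) = inner ℂ (χ s) (e n))
    (hχ : Summable fun s => w s * ‖χ s‖) {z : ℂ}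
    (hz : HasSum (fun s => ((w s : ℝ) : ℂ) * inner ℂ (χ s) (φ s)) z) :
    HasSum (fun n => inner ℂ (e n) (diagonal φ w (ψ n))) z := by
  let b := HilbertBasis.mk he hd.ge
  have hb : ∀ n, b n = e n := fun n => by rw [HilbertBasis.coe_mk]
  -- the trace is the sum over `s` and `n` of `F`, in either order
  let F : σ × ℕ → ℂ := fun p => ((w p.1 : ℝ) : ℂ) * (inner ℂ (χ p.1) (e p.2) *
    inner ℂ (e p.2) (φ p.1))
  have hn : ∀ n, HasSum (fun s => F (s, n)) (inner ℂ (e n) (diagonal φ w (ψ n))) := by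
    intro n
    have := (hasSum_diagonal hφ hw hs (ψ n)).mapL (innerSL ℂ (e n))
    simp only [innerSL_apply_apply, inner_smul_right, hadj] at this
    exact this
  have hsn : ∀ s, HasSum (fun n => F (s, n)) (((w s : ℝ) : ℂ) * inner ℂ (χ s) (φ s)) := by
    intro s
    have := (b.hasSum_inner_mul_inner (χ s) (φ s)).mul_left ((w s : ℝ) : ℂ)
    simpa only [hb] using this
  -- Cauchy-Schwarz and Bessel
  have hfin : ∀ s (t : Finset ℕ), ∑ n ∈ t, ‖F (s, n)‖ ≤ w s * ‖χ s‖ := by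
    intro s t
    have e1 : ∑ n ∈ t, ‖F (s, n)‖ =
        w s * ∑ n ∈ t, ‖inner ℂ (e n) (χ s)‖ * ‖inner ℂ (e n) (φ s)‖ := by
      rw [Finset.mul_sum]
      refine Finset.sum_congr rfl fun n _ => ?_
      simp only [F, norm_mul]
      rw [Complex.norm_real, Real.norm_of_nonneg (hw s), norm_inner_symm (χ s)]
    rw [e1]
    refine mul_le_mul_of_nonneg_left ?_ (hw s)
    refine (Real.sum_mul_le_sqrt_mul_sqrt t _ _).trans ?_
    have h1 := Real.sqrt_le_sqrt (he.sum_inner_products_le (χ s) (s := t))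
    have h2 := Real.sqrt_le_sqrt (he.sum_inner_products_le (φ s) (s := t))
    rw [Real.sqrt_sq (norm_nonneg _)] at h1 h2
    rw [hφ.1 s] at h2
    calc _ ≤ ‖χ s‖ * 1 := mul_le_mul h1 h2 (Real.sqrt_nonneg _) (norm_nonneg _)
      _ = _ := mul_one _
  have hF : Summable F := by
    refine Summable.of_norm ?_
    rw [summable_prod_of_nonneg fun p => norm_nonneg _]
    have h1 : ∀ s, Summable fun n => ‖F (s, n)‖ := fun s =>
      summable_of_sum_le (fun n => norm_nonneg _) (hfin s)
    refine ⟨h1, Summable.of_nonneg_of_le (fun s => tsum_nonneg fun n => norm_nonneg _)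
      (fun s => (h1 s).tsum_le_of_sum_le (hfin s)) hχ⟩
  have hFz : HasSum F z := by
    have := hF.hasSum.prod_fiberwise hsn
    rw [hz.unique this]
    exact hF.hasSum
  have := ((Equiv.prodComm ℕ σ).hasSum_iff (f := F)).2 hFz
  exact this.prod_fiberwise hn

/-- The diagonal operator multiplies by `v` every vector whose components sit only where the weight
is `v`. -/
theorem diagonal_apply_of_components (hφ : Orthonormal ℂ φ) (hw : ∀ s, 0 ≤ w s) (hs : Summable w)
    (hd : (Submodule.span ℂ (Set.range φ)).topologicalClosure = ⊤) {x : H} {v : ℝ}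
    (hx : ∀ s, inner ℂ (φ s) x ≠ 0 → w s = v) : diagonal φ w x = ((v : ℝ) : ℂ) • x := by
  let b := HilbertBasis.mk hφ hd.ge
  have hb : ∀ s, b s = φ s := fun s => by rw [HilbertBasis.coe_mk]
  refine (hasSum_diagonal hφ hw hs x).unique ?_
  have := (b.hasSum_repr x).const_smul ((v : ℝ) : ℂ)
  refine this.congr_fun fun s => ?_
  rw [b.repr_apply_apply, hb]
  by_cases h : inner ℂ (φ s) x = 0
  · simp [h]
  · rw [hx s h]

end Trace

/-! ### Uniqueness of the Boltzmann operator -/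

section Gibbs

variable {L : Type*} [Fintype L] {σ : Type*}

/-- A complete orthonormal system of Schwartz eigenfunctions of a symmetric operator determines the
Boltzmann operator: the eigenfunctions `e n` in another such system have components only along the
`f s` with the same eigenvalue. -/
theorem eq_diagonal_of_isBoltzmannOperator {A : 𝓢(Config L, ℂ) →L[ℂ] 𝓢(Config L, ℂ)}
    (hA : ∀ f g, inner ℂ (toHilb L (A f)) (toHilb L g) = inner ℂ (toHilb L f) (toHilb L (A g)))
    {f : σ → 𝓢(Config L, ℂ)} {E : σ → ℝ} {T : ℝ}
    (ho : Orthonormal ℂ fun s => toHilb L (f s))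
    (hd : (Submodule.span ℂ (Set.range fun s => toHilb L (f s))).topologicalClosure = ⊤)
    (hE : ∀ s, A (f s) = ((E s : ℝ) : ℂ) • f s)
    (hs : Summable fun s => Real.exp (-E s / T)) {B : Hilb L →L[ℂ] Hilb L}
    (hB : IsBoltzmannOperator A T B) :
    B = diagonal (fun s => toHilb L (f s)) fun s => Real.exp (-E s / T) := by
  obtain ⟨e, E', ⟨-, hed⟩, heE, heB⟩ := hB
  refine ContinuousLinearMap.ext_on (s := Set.range fun n => toHilb L (e n)) ?_ ?_
  · rw [dense_iff_closure_eq, ← Submodule.topologicalClosure_coe, hed, Submodule.top_coe]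
  · rintro _ ⟨n, rfl⟩
    simp only
    rw [heB]
    refine (diagonal_apply_of_components ho (fun s => (Real.exp_pos _).le) hs hd ?_).symm
    intro s hne
    have h := hA (f s) (e n)
    rw [hE, heE, map_smul, map_smul, inner_smul_left, inner_smul_right, Complex.conj_ofReal] at h
    have := mul_right_cancel₀ hne h
    rw [Complex.ofReal_inj.1 this]

end Gibbs

/-! ### Gaussians are Schwartz functions -/

/-- A Gaussian decays faster than every power: `exp (1 + t)` dominates the power, and completing the
square bounds its product with the Gaussian. -/
theorem one_add_pow_mul_exp_le {c : ℝ} (hc : 0 < c) (M : ℕ) {t : ℝ} (ht : 0 ≤ t) :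
    (1 + t) ^ M * Real.exp (-(c * t ^ 2)) ≤ M.factorial * Real.exp (1 + 1 / (4 * c)) := by
  have h1 := Real.pow_div_factorial_le_exp (x := 1 + t) (by positivity) M
  rw [div_le_iff₀ (by positivity)] at h1
  calc (1 + t) ^ M * Real.exp (-(c * t ^ 2))
      ≤ Real.exp (1 + t) * M.factorial * Real.exp (-(c * t ^ 2)) := by gcongr
    _ = M.factorial * Real.exp (1 + t + -(c * t ^ 2)) := by rw [Real.exp_add (1 + t)]; ring
    _ ≤ M.factorial * Real.exp (1 + 1 / (4 * c)) := by
        refine mul_le_mul_of_nonneg_left (Real.exp_le_exp.2 ?_) (by positivity)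
        have h2 : t + -(c * t ^ 2) = 1 / (4 * c) - c * (t - 1 / (2 * c)) ^ 2 := by
          field_simp; ring
        have h3 : 0 ≤ c * (t - 1 / (2 * c)) ^ 2 := by positivity
        linarith

section Gaussian

variable {E : Type*} [NormedAddCommGroup E] [NormedSpace ℝ E]

/-- The Schwartz function `exp (-q)`, for a smooth function `q` of temperate growth that dominates
a multiple of the square of the norm. -/
def gaussian (q : E → ℝ) (hq : q.HasTemperateGrowth)
    (hc : ∃ c > 0, ∀ x, c * ‖x‖ ^ 2 ≤ q x) : 𝓢(E, ℂ) :=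
  SchwartzMap.postcompCLM (𝕜 := ℝ) Complex.ofRealCLM
  { toFun := fun x => Real.exp (-q x)
    smooth' := Real.contDiff_exp.comp hq.1.neg
    decay' := by
      intro p n
      obtain ⟨c, hc, hcq⟩ := hc
      obtain ⟨k, C, hC, hb⟩ := hq.neg.norm_iteratedFDeriv_le_uniform n
      refine ⟨n.factorial * (1 + C) ^ n *
        ((p + k * n).factorial * Real.exp (1 + 1 / (4 * c))), fun x => ?_⟩
      have hx : 0 ≤ ‖x‖ := norm_nonneg x
      have hD : ∀ i, 1 ≤ i → i ≤ n → ‖iteratedFDeriv ℝ i (-q) x‖ ≤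
          ((1 + C) * (1 + ‖x‖) ^ k) ^ i := by
        intro i hi hin
        have h1 : 1 ≤ (1 + ‖x‖) ^ k := one_le_pow₀ (by linarith)
        have h2 : 1 ≤ (1 + C) * (1 + ‖x‖) ^ k := by nlinarith
        calc _ ≤ C * (1 + ‖x‖) ^ k := hb i hin x
          _ ≤ (1 + C) * (1 + ‖x‖) ^ k := by nlinarith
          _ ≤ _ := le_self_pow₀ h2 (by omega)
      -- Faà di Bruno: all derivatives of `exp` are `exp`, those of `q` are polynomially bounded
      have hmain := norm_iteratedFDeriv_comp_le (𝕜 := ℝ) (g := Real.exp) (f := -q) (n := n)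
        (N := n) Real.contDiff_exp
        (hq.neg.1.of_le (by exact_mod_cast le_top)) le_rfl x (C := Real.exp (-q x)) (fun i _ => by
          rw [norm_iteratedFDeriv_eq_norm_iteratedDeriv, iteratedDeriv_eq_iterate,
            Real.iter_deriv_exp]
          simp) hD
      have h3 : Real.exp (-q x) ≤ Real.exp (-(c * ‖x‖ ^ 2)) :=
        Real.exp_le_exp.2 (neg_le_neg (hcq x))
      have h4 := one_add_pow_mul_exp_le hc (p + k * n) hx
      calc ‖x‖ ^ p * ‖iteratedFDeriv ℝ n (fun x => Real.exp (-q x)) x‖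
          ≤ (1 + ‖x‖) ^ p * (n.factorial * Real.exp (-(c * ‖x‖ ^ 2)) *
              ((1 + C) * (1 + ‖x‖) ^ k) ^ n) := by
            refine mul_le_mul (pow_le_pow_left₀ hx (by linarith) p) (hmain.trans ?_)
              (norm_nonneg _) (by positivity)
            gcongr
        _ = n.factorial * (1 + C) ^ n *
              ((1 + ‖x‖) ^ (p + k * n) * Real.exp (-(c * ‖x‖ ^ 2))) := by
            rw [pow_add, pow_mul, mul_pow (1 + C)]; ring
        _ ≤ _ := by gcongr }

theorem gaussian_apply (q : E → ℝ) (hq : q.HasTemperateGrowth)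
    (hc : ∃ c > 0, ∀ x, c * ‖x‖ ^ 2 ≤ q x) (x : E) :
    gaussian q hq hc x = ((Real.exp (-q x) : ℝ) : ℂ) := rfl

end Gaussian

/-! ### Canonical commutation relations on the Schwartz space -/

section CCR

variable {L : Type*} [Fintype L]

/-- Multiplication by the linear functional `⟪v, ·⟫`. -/
def posDir (v : Config L) : 𝓢(Config L, ℂ) →L[ℂ] 𝓢(Config L, ℂ) :=
  SchwartzMap.smulLeftCLM ℂ (fun x : Config L => ((inner ℝ v x : ℝ) : ℂ))

/-- The momentum operator `-i ∂_v` in the direction `v`. -/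
def momDir (v : Config L) : 𝓢(Config L, ℂ) →L[ℂ] 𝓢(Config L, ℂ) :=
  (-Complex.I) • LineDeriv.lineDerivOpCLM ℂ 𝓢(Config L, ℂ) v

theorem posDir_apply (v : Config L) (f : 𝓢(Config L, ℂ)) (x : Config L) :
    posDir v f x = ((inner ℝ v x : ℝ) : ℂ) * f x := by
  have h : (fun x : Config L => ((inner ℝ v x : ℝ) : ℂ)).HasTemperateGrowth :=
    (Complex.ofRealCLM.comp (innerSL ℝ v)).hasTemperateGrowth
  rw [posDir, SchwartzMap.smulLeftCLM_apply_apply h, smul_eq_mul]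

theorem momDir_apply (v : Config L) (f : 𝓢(Config L, ℂ)) (x : Config L) :
    momDir v f x = -Complex.I * fderiv ℝ f x v := by
  rw [← SchwartzMap.lineDerivOp_apply_eq_fderiv]
  rfl

theorem posDir_pow_apply (v : Config L) (n : ℕ) (f : 𝓢(Config L, ℂ)) (x : Config L) :
    ((posDir v)^[n]) f x = ((inner ℝ v x : ℝ) : ℂ) ^ n * f x := by
  induction n with
  | zero => simp
  | succ n ih => rw [Function.iterate_succ_apply', posDir_apply, ih, pow_succ']; ring

theorem posDir_comm (v w : Config L) (f : 𝓢(Config L, ℂ)) :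
    posDir v (posDir w f) = posDir w (posDir v f) := by
  ext x
  simp only [posDir_apply]
  ring

/-- Symmetry of the second derivative. -/
theorem momDir_comm (v w : Config L) (f : 𝓢(Config L, ℂ)) :
    momDir v (momDir w f) = momDir w (momDir v f) := by
  ext x
  have h : ∀ v w : Config L, momDir v (momDir w f) x =
      -Complex.I * (-Complex.I * fderiv ℝ (fderiv ℝ f) x v w) := by
    intro v w
    rw [momDir_apply]
    have e : (momDir w f : Config L → ℂ) = fun y => -Complex.I * fderiv ℝ f y w :=
      funext fun y => momDir_apply w f y
    have hd : DifferentiableAt ℝ (fderiv ℝ f) x :=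
      ((f.contDiffAt 2 (x := x)).fderiv_right (m := 1) (by norm_num)).differentiableAt (by norm_num)
    rw [e, fderiv_const_mul (hd.clm_apply (differentiableAt_const w)), fderiv_clm_apply hd
      (differentiableAt_const w)]
    simp
  rw [h, h]
  have hs := (f.contDiffAt 2 (x := x)).isSymmSndFDerivAt (by simp)
  rw [hs.eq v w]

/-- The canonical commutation relation `[P_v, X_w] = -i ⟪v, w⟫`. -/
theorem momDir_posDir (v w : Config L) (f : 𝓢(Config L, ℂ)) :
    momDir v (posDir w f) = posDir w (momDir v f) - (Complex.I * (inner ℝ v w : ℝ)) • f := by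
  ext x
  have e : (posDir w f : Config L → ℂ) = fun y => ((inner ℝ w y : ℝ) : ℂ) * f y :=
    funext fun y => posDir_apply w f y
  have hl : HasFDerivAt (fun y : Config L => ((inner ℝ w y : ℝ) : ℂ))
      (Complex.ofRealCLM.comp (innerSL ℝ w)) x :=
    (Complex.ofRealCLM.comp (innerSL ℝ w)).hasFDerivAt
  have hf := f.hasFDerivAt x
  rw [momDir_apply, e, (show fderiv ℝ (fun y => ((inner ℝ w y : ℝ) : ℂ) * f y) x = _ from
    (hl.mul hf).fderiv), sub_apply, smul_apply,
    posDir_apply, momDir_apply]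
  simp [real_inner_comm]
  ring

theorem toHilb_injective : Function.Injective (toHilb L) :=
  SchwartzMap.injective_toLp (F := ℂ) (E := Config L) 2 volume

theorem inner_toHilb (f g : 𝓢(Config L, ℂ)) :
    inner ℂ (toHilb L f) (toHilb L g) = ∫ x, starRingEnd ℂ (f x) * g x := by
  have h := SchwartzMap.inner_toL2_toL2_eq f g volume
  simp only [RCLike.inner_apply'] at h
  exact h

theorem inner_posDir (v : Config L) (f g : 𝓢(Config L, ℂ)) :
    inner ℂ (toHilb L (posDir v f)) (toHilb L g) =
      inner ℂ (toHilb L f) (toHilb L (posDir v g)) := by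
  rw [inner_toHilb, inner_toHilb]
  congr 1
  funext x
  rw [posDir_apply, posDir_apply, map_mul, Complex.conj_ofReal]
  ring

/-- Integration by parts. -/
theorem inner_momDir (v : Config L) (f g : 𝓢(Config L, ℂ)) :
    inner ℂ (toHilb L (momDir v f)) (toHilb L g) =
      inner ℂ (toHilb L f) (toHilb L (momDir v g)) := by
  rw [inner_toHilb, inner_toHilb]
  have h := SchwartzMap.integral_bilinear_lineDerivOp_right_eq_neg_left (μ := volume) f g
    ((ContinuousLinearMap.mul ℝ ℂ).comp (Complex.conjCLE : ℂ →L[ℝ] ℂ)) v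
  simp only [ContinuousLinearMap.comp_apply, ContinuousLinearMap.mul_apply',
    SchwartzMap.lineDerivOp_apply_eq_fderiv] at h
  have h1 : ∀ x, starRingEnd ℂ (momDir v f x) * g x =
      Complex.I * (starRingEnd ℂ (fderiv ℝ f x v) * g x) := by
    intro x
    rw [momDir_apply, map_mul, map_neg, Complex.conj_I]
    ring
  have h2 : ∀ x, starRingEnd ℂ (f x) * momDir v g x =
      -Complex.I * (starRingEnd ℂ (f x) * fderiv ℝ g x v) := by
    intro x
    rw [momDir_apply]
    ring
  simp_rw [h1, h2]
  rw [integral_const_mul, integral_const_mul]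
  have h3 : ∫ x, starRingEnd ℂ (f x) * fderiv ℝ g x v =
    -∫ x, starRingEnd ℂ (fderiv ℝ f x v) * g x := h
  rw [h3]
  ring

theorem position_eq_sum [DecidableEq L] (u : OrthonormalBasis L ℝ (EuclideanSpace ℝ L)) (i : L)
    (f : 𝓢(Config L, ℂ)) : position i f = ∑ k, ((u k i : ℝ) : ℂ) • posDir (u k) f := by
  ext x
  rw [position_apply, sum_apply]
  simp only [smul_apply, posDir_apply, smul_eq_mul, ← mul_assoc, ← Finset.sum_mul]
  congr 1
  have h := congrArg (fun y : Config L => y i) (u.sum_repr' x)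
  simp only [PiLp.smul_apply, smul_eq_mul, WithLp.ofLp_sum, Finset.sum_apply] at h
  rw [← h]
  push_cast
  exact Finset.sum_congr rfl fun k _ => by simp [mul_comm]

theorem momentum_eq_sum [DecidableEq L] (u : OrthonormalBasis L ℝ (EuclideanSpace ℝ L)) (i : L)
    (f : 𝓢(Config L, ℂ)) : momentum i f = ∑ k, ((u k i : ℝ) : ℂ) • momDir (u k) f := by
  ext x
  have e : momentum i f x = momDir (EuclideanSpace.single i (1 : ℝ)) f x := rfl
  rw [e, sum_apply]
  simp only [smul_apply, momDir_apply, smul_eq_mul]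
  have h := u.sum_repr' (EuclideanSpace.single i (1 : ℝ))
  conv_lhs => rw [← h]
  rw [map_sum, Finset.mul_sum]
  refine Finset.sum_congr rfl fun k _ => ?_
  rw [map_smul, EuclideanSpace.inner_single_right]
  simp
  ring

end CCR

/-! ### Polynomials times a Gaussian are dense in `L²` -/

section Density

open scoped FourierTransform ContDiff Nat

variable {L : Type*} [Fintype L]

/-- Injectivity of the Fourier transform on `L¹`, by duality with the Schwartz space. -/
theorem ae_eq_zero_of_fourier_eq_zero {F : Config L → ℂ} (hF : Integrable F)
    (h : ∀ v, 𝓕 F v = 0) : F =ᵐ[volume] 0 := by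
  refine ae_eq_zero_of_integral_contDiff_smul_eq_zero hF.locallyIntegrable fun g hg hgs => ?_
  have hg' : ContDiff ℝ ∞ fun x => ((g x : ℝ) : ℂ) := Complex.ofRealCLM.contDiff.comp hg
  have hgs' : HasCompactSupport fun x => ((g x : ℝ) : ℂ) :=
    hgs.comp_left (g := fun t : ℝ => (t : ℂ)) Complex.ofReal_zero
  let γ : 𝓢(Config L, ℂ) := hgs'.toSchwartzMap hg'
  have h1 : ∫ ξ, (𝓕 F ξ) • ((𝓕⁻ γ : 𝓢(Config L, ℂ)) ξ) =
      ∫ x, F x • 𝓕 ((𝓕⁻ γ : 𝓢(Config L, ℂ)) : Config L → ℂ) x := by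
    simpa using! (VectorFourier.integral_fourierIntegral_smul_eq_flip (L := innerₗ (Config L))
      Real.continuous_fourierChar continuous_inner hF (𝓕⁻ γ : 𝓢(Config L, ℂ)).integrable)
  rw [← SchwartzMap.fourier_coe, FourierTransform.fourier_fourierInv_eq] at h1
  simp only [h, zero_smul, integral_zero] at h1
  rw [h1]
  refine integral_congr_ae (Filter.Eventually.of_forall fun x => ?_)
  show g x • F x = F x • ((g x : ℝ) : ℂ)
  rw [Complex.real_smul, smul_eq_mul, mul_comm]

variable {q : Config L → ℝ} {hq : q.HasTemperateGrowth} {hc : ∃ c > 0, ∀ x, c * ‖x‖ ^ 2 ≤ q x}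

/-- Exponential moments of a Gaussian times a square integrable function: half of the exponent
absorbs `exp (a ‖x‖)` by completing the square, and the other half is still square integrable. -/
theorem integrable_exp_norm_mul_gaussian_mul (F : Hilb L) {a : ℝ} :
    Integrable fun x : Config L => Real.exp (a * ‖x‖) * ‖gaussian q hq hc x * F x‖ := by
  obtain ⟨c, hc0, hcq⟩ := hc
  have hq2 : (fun x : Config L => c / 2 * ‖x‖ ^ 2).HasTemperateGrowth :=
    (Function.HasTemperateGrowth.const (c / 2)).mul
      (Function.hasTemperateGrowth_norm_sq (H := Config L))
  let γ := gaussian (fun x : Config L => c / 2 * ‖x‖ ^ 2) hq2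
    ⟨c / 2, by positivity, fun x => le_rfl⟩
  have h1 : Integrable fun x => γ x * F x := (γ.memLp 2).integrable_mul (Lp.memLp F)
  refine (h1.norm.const_mul (Real.exp (a ^ 2 / (2 * c)))).mono' ?_
    (Filter.Eventually.of_forall fun x => ?_)
  · have h2 : Continuous fun x : Config L => Real.exp (a * ‖x‖) := by fun_prop
    refine h2.aestronglyMeasurable.mul ?_
    exact ((SchwartzMap.continuous _).aestronglyMeasurable.mul (Lp.aestronglyMeasurable F)).norm
  · rw [norm_mul, norm_norm, norm_mul, norm_mul, Real.norm_of_nonneg (Real.exp_pos _).le,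
      ← mul_assoc, ← mul_assoc]
    refine mul_le_mul_of_nonneg_right ?_ (norm_nonneg _)
    rw [gaussian_apply, gaussian_apply, Complex.norm_real, Complex.norm_real,
      Real.norm_of_nonneg (Real.exp_pos _).le, Real.norm_of_nonneg (Real.exp_pos _).le,
      ← Real.exp_add, ← Real.exp_add]
    apply Real.exp_le_exp.2
    have h2 := hcq x
    have h3 : 0 ≤ c / 2 * (‖x‖ - a / c) ^ 2 := by positivity
    have h4 : c / 2 * (‖x‖ - a / c) ^ 2 = c / 2 * ‖x‖ ^ 2 - a * ‖x‖ + a ^ 2 / (2 * c) := by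
      field_simp; ring
    linarith

/-- A square integrable function that is orthogonal to all powers of linear functionals times a
Gaussian vanishes: the Fourier transform of its product with the Gaussian is the sum of the
exponential series of these moments. -/
theorem eq_zero_of_gaussian_moments {F : Hilb L}
    (h : ∀ (v : Config L) (n : ℕ),
      ∫ x, ((inner ℝ v x : ℝ) : ℂ) ^ n * (gaussian q hq hc x * F x) = 0) : F = 0 := by
  have hint : Integrable fun x => gaussian q hq hc x * F x :=
    ((gaussian q hq hc).memLp 2).integrable_mul (Lp.memLp F)
  have hfour : ∀ v, 𝓕 (fun x => gaussian q hq hc x * F x) v = 0 := by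
    intro v
    rw [Real.fourier_eq']
    set a : ℝ := 2 * Real.pi * ‖v‖ with ha
    have ha0 : 0 ≤ a := by positivity
    let t : Config L → ℂ := fun x => ((-2 * Real.pi * inner ℝ x v : ℝ) : ℂ) * Complex.I
    have ht : ∀ x, ‖t x‖ ≤ a * ‖x‖ := by
      intro x
      rw [norm_mul, Complex.norm_I, mul_one, Complex.norm_real, norm_mul, norm_mul, norm_neg,
        Real.norm_ofNat, Real.norm_of_nonneg Real.pi_pos.le, ha]
      have := norm_inner_le_norm (𝕜 := ℝ) x v
      calc 2 * Real.pi * ‖inner ℝ x v‖ ≤ 2 * Real.pi * (‖x‖ * ‖v‖) := by gcongr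
        _ = _ := by ring
    have hs := hasSum_integral_of_dominated_convergence (μ := (volume : Measure (Config L)))
      (F := fun (n : ℕ) x => t x ^ n / n ! * (gaussian q hq hc x * F x))
      (f := fun x => Complex.exp (t x) • (gaussian q hq hc x * F x))
      (fun n x => (a * ‖x‖) ^ n / n ! * ‖gaussian q hq hc x * F x‖)
      (fun n => by
        refine AEStronglyMeasurable.mul ?_ hint.aestronglyMeasurable
        exact (by fun_prop : Continuous fun x => t x ^ n / n !).aestronglyMeasurable)
      (fun n => Filter.Eventually.of_forall fun x => by
        rw [norm_mul, norm_div, norm_pow, Complex.norm_natCast]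
        have := ht x
        gcongr)
      (Filter.Eventually.of_forall fun x =>
        (Real.summable_pow_div_factorial (a * ‖x‖)).mul_right _)
      (by
        refine (integrable_exp_norm_mul_gaussian_mul (hq := hq) (hc := hc) F (a := a)).congr
          (Filter.Eventually.of_forall fun x => ?_)
        simp only
        rw [tsum_mul_right, Real.exp_eq_exp_ℝ, NormedSpace.exp_eq_tsum_div])
      (Filter.Eventually.of_forall fun x => by
        have := NormedSpace.expSeries_div_hasSum_exp (t x)
        rw [← Complex.exp_eq_exp_ℂ] at this
        exact this.mul_right _)
    refine hs.unique ?_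
    have hz : ∀ n : ℕ, ∫ x, t x ^ n / n ! * (gaussian q hq hc x * F x) = 0 := by
      intro n
      have e : ∀ x, t x ^ n / n ! * (gaussian q hq hc x * F x) =
          ((-2 * Real.pi : ℝ) * Complex.I : ℂ) ^ n / n ! *
            (((inner ℝ v x : ℝ) : ℂ) ^ n * (gaussian q hq hc x * F x)) := by
        intro x
        simp only [t]
        rw [real_inner_comm, Complex.ofReal_mul]
        ring
      simp_rw [e]
      rw [integral_const_mul, h v n, mul_zero]
    simp only [hz]
    exact hasSum_zero
  have h0 := ae_eq_zero_of_fourier_eq_zero hint hfour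
  refine Lp.ext ?_
  filter_upwards [h0, Lp.coeFn_zero ℂ 2 (volume : Measure (Config L))] with x hx hx0
  rw [hx0]
  have hne : gaussian q hq hc x ≠ 0 := by
    rw [gaussian_apply]
    exact_mod_cast (Real.exp_pos _).ne'
  simpa [hne] using hx

end Density

/-! ### The normal modes of the lattice -/

section Modes

variable {L : Type*} [Fintype L]

theorem modeForm_hasTemperateGrowth (u : OrthonormalBasis L ℝ (EuclideanSpace ℝ L)) (α : L → ℝ) :
    (fun x : Config L => ∑ k, α k ^ 2 * inner ℝ (u k) x ^ 2).HasTemperateGrowth := by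
  refine Function.HasTemperateGrowth.sum fun k _ => ?_
  exact (Function.HasTemperateGrowth.const (α k ^ 2)).mul
    ((Function.hasTemperateGrowth_inner_right (u k)).pow 2)

theorem modeForm_coercive [Nonempty L] (u : OrthonormalBasis L ℝ (EuclideanSpace ℝ L)) {α : L → ℝ}
    (hα : ∀ k, 0 < α k) :
    ∃ c > 0, ∀ x : Config L, c * ‖x‖ ^ 2 ≤ ∑ k, α k ^ 2 * inner ℝ (u k) x ^ 2 := by
  obtain ⟨k₀, hk₀⟩ := Finite.exists_min α
  refine ⟨α k₀ ^ 2, by have := hα k₀; positivity, fun x => ?_⟩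
  rw [← u.sum_sq_inner_right x, Finset.mul_sum]
  refine Finset.sum_le_sum fun k _ => ?_
  have := hα k₀
  have := hk₀ k
  gcongr

/-- Normal modes: an orthonormal basis of normal directions `u k` and scales `α k`, `β k` with
`2 α β = 1`, so that `A = α X + i β P` satisfies `[A, A†] = 1`.  The frequencies are not part of the
data. -/
structure NormalModes (L : Type*) [Fintype L] where
  /-- the normal directions -/
  u : OrthonormalBasis L ℝ (EuclideanSpace ℝ L)
  /-- the coefficient of the position -/
  α : L → ℝ
  /-- the coefficient of the momentum -/
  β : L → ℝ
  α_pos : ∀ k, 0 < α k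
  two_mul_α_β : ∀ k, 2 * α k * β k = 1

namespace NormalModes

variable (M : NormalModes L)

/-- The combination `a X + i b P` of position and momentum of the mode `k`. -/
def ladder (k : L) (a b : ℝ) : 𝓢(Config L, ℂ) →ₗ[ℂ] 𝓢(Config L, ℂ) :=
  (a : ℂ) • (posDir (M.u k)).toLinearMap + (Complex.I * b) • (momDir (M.u k)).toLinearMap

theorem ladder_apply (k : L) (a b : ℝ) (f : 𝓢(Config L, ℂ)) :
    M.ladder k a b f = (a : ℂ) • posDir (M.u k) f + (Complex.I * b) • momDir (M.u k) f := rfl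

theorem ladder_comm [DecidableEq L] (k l : L) (a b c d : ℝ) (f : 𝓢(Config L, ℂ)) :
    M.ladder k a b (M.ladder l c d f) = M.ladder l c d (M.ladder k a b f) +
      if k = l then ((b * c - a * d : ℝ) : ℂ) • f else 0 := by
  have h : ((inner ℝ (M.u k) (M.u l) : ℝ) : ℂ) = if k = l then 1 else 0 := by
    rw [orthonormal_iff_ite.1 M.u.orthonormal k l]; split_ifs <;> simp
  have h' : ((inner ℝ (M.u l) (M.u k) : ℝ) : ℂ) = if k = l then 1 else 0 := by
    rw [real_inner_comm, h]
  simp only [ladder_apply, map_add, map_smul, momDir_posDir, h, h',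
    posDir_comm (M.u k) (M.u l), momDir_comm (M.u k) (M.u l)]
  have hI : Complex.I * Complex.I = -1 := Complex.I_mul_I
  split_ifs with hkl
  · push_cast
    match_scalars
    all_goals first | linear_combination (a * d - b * c : ℂ) * hI | ring
  · module

theorem inner_ladder (k : L) (a b : ℝ) (f g : 𝓢(Config L, ℂ)) :
    inner ℂ (toHilb L (M.ladder k a b f)) (toHilb L g) =
      inner ℂ (toHilb L f) (toHilb L (M.ladder k a (-b) g)) := by
  simp only [ladder_apply, map_add, map_smul, inner_add_left, inner_add_right, inner_smul_left,
    inner_smul_right, inner_posDir, inner_momDir, map_mul, Complex.conj_I, Complex.conj_ofReal]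
  push_cast
  ring

variable [Nonempty L]

/-- The ground state `exp (-∑ k, α k ^ 2 * ⟪u k, x⟫ ^ 2)` of the normal modes, not normalised. -/
def vacuum : 𝓢(Config L, ℂ) :=
  gaussian _ (modeForm_hasTemperateGrowth M.u M.α) (modeForm_coercive M.u M.α_pos)

theorem vacuum_apply (x : Config L) :
    M.vacuum x = ((Real.exp (-∑ k, M.α k ^ 2 * inner ℝ (M.u k) x ^ 2) : ℝ) : ℂ) := rfl

theorem ladder_vacuum (k : L) : M.ladder k (M.α k) (M.β k) M.vacuum = 0 := by
  ext x
  rw [ladder_apply, add_apply, smul_apply, smul_apply, posDir_apply, momDir_apply]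
  have hq : HasFDerivAt (fun y : Config L => ∑ l, M.α l ^ 2 * inner ℝ (M.u l) y ^ 2)
      (∑ l, (M.α l ^ 2) • ((2 * inner ℝ (M.u l) x) • innerSL ℝ (M.u l))) x := by
    refine HasFDerivAt.fun_sum fun l _ => ?_
    have h1 : HasFDerivAt (fun y : Config L => inner ℝ (M.u l) y) (innerSL ℝ (M.u l)) x :=
      (innerSL ℝ (M.u l)).hasFDerivAt
    have := (h1.pow 2).const_mul (M.α l ^ 2)
    simpa using this
  have hd := Complex.ofRealCLM.hasFDerivAt.comp x hq.neg.exp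
  have e : fderiv ℝ M.vacuum x (M.u k) =
      -(2 * M.α k ^ 2 * inner ℝ (M.u k) x : ℝ) * M.vacuum x := by
    have : fderiv ℝ M.vacuum x = _ := HasFDerivAt.fderiv hd
    rw [this]
    have hs : (∑ l, (M.α l ^ 2) • ((2 * inner ℝ (M.u l) x) • innerSL ℝ (M.u l))) (M.u k) =
        2 * M.α k ^ 2 * inner ℝ (M.u k) x := by
      rw [sum_apply, Finset.sum_eq_single k]
      · simp [M.u.orthonormal.1 k]; ring
      · intro l _ hl
        simp [M.u.orthonormal.2 hl]
      · simp
    simp only [ContinuousLinearMap.comp_apply, smul_apply, neg_apply, hs, vacuum_apply]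
    simp
    ring
  rw [e]
  have h2 : (2 * M.α k * M.β k : ℂ) = 1 := by exact_mod_cast M.two_mul_α_β k
  simp only [smul_eq_mul, zero_apply]
  push_cast
  linear_combination (-(M.α k : ℂ) * inner ℝ (M.u k) x * M.vacuum x) * h2 +
    2 * M.β k * M.α k ^ 2 * inner ℝ (M.u k) x * M.vacuum x * Complex.I_mul_I

variable [DecidableEq L]

/-- The ladder operators of the normal modes. -/
def system : LadderSystem L 𝓢(Config L, ℂ) (Hilb L) where
  emb := (toHilb L).toLinearMap
  ann k := M.ladder k (M.α k) (M.β k)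
  cre k := M.ladder k (M.α k) (-M.β k)
  vac := M.vacuum
  cre_comm k l f := by
    rw [ladder_comm]
    split_ifs with h
    · subst h; simp; left; ring
    · rw [add_zero]
  ann_cre k l f := by
    rw [ladder_comm]
    congr 1
    split_ifs with h
    · subst h
      have : M.β k * M.α k - M.α k * -M.β k = 1 := by linarith [M.two_mul_α_β k]
      rw [this, Complex.ofReal_one, one_smul]
    · rfl
  inner_cre k f g := by
    have := M.inner_ladder k (M.α k) (-M.β k) f g
    rwa [neg_neg] at this
  ann_vac := M.ladder_vacuum
  emb_vac h := by
    have h1 : M.vacuum = 0 := toHilb_injective (h.trans (map_zero _).symm)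
    have h2 := congrArg (fun f : 𝓢(Config L, ℂ) => f 0) h1
    simp [vacuum_apply] at h2

theorem system_emb (f : 𝓢(Config L, ℂ)) : M.system.emb f = toHilb L f := rfl

theorem posDir_eq (k : L) (f : 𝓢(Config L, ℂ)) : posDir (M.u k) f =
    ((1 / (2 * M.α k) : ℝ) : ℂ) • (M.system.ann k f + M.system.cre k f) := by
  have h : (M.α k : ℂ) ≠ 0 := by exact_mod_cast (M.α_pos k).ne'
  simp only [system, ladder_apply]
  push_cast
  match_scalars
  · field_simp; norm_num
  · ring

theorem momDir_eq (k : L) (f : 𝓢(Config L, ℂ)) : momDir (M.u k) f =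
    (-Complex.I * (1 / (2 * M.β k) : ℝ)) • (M.system.ann k f - M.system.cre k f) := by
  have h : (M.β k : ℂ) ≠ 0 := by
    have : M.β k ≠ 0 := by
      intro h0
      have := M.two_mul_α_β k
      rw [h0] at this
      simp at this
    exact_mod_cast this
  simp only [system, ladder_apply]
  push_cast
  match_scalars
  · field_simp
    linear_combination 2 * Complex.I_sq
  · ring

/-! ### Completeness of the occupation-number states -/

/-- Polynomials in linear functionals times the ground state are combinations of occupation-number
states. -/
theorem posDir_pow_vacuum_mem (v : Config L) (n : ℕ) :
    ((posDir v)^[n]) M.vacuum ∈ Submodule.span ℂ (Set.range M.system.state) := by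
  have hstate : ∀ s, M.system.state s ∈ Submodule.span ℂ (Set.range M.system.state) := fun s =>
    Submodule.subset_span ⟨s, rfl⟩
  have hmode : ∀ k, ∀ f ∈ Submodule.span ℂ (Set.range M.system.state),
      posDir (M.u k) f ∈ Submodule.span ℂ (Set.range M.system.state) := by
    intro k f hf
    induction hf using Submodule.span_induction with
    | mem f hf =>
      obtain ⟨s, rfl⟩ := hf
      rw [M.posDir_eq, M.system.ann_state, ← M.system.state_cons]
      exact Submodule.smul_mem _ _ (Submodule.add_mem _ (Submodule.smul_mem _ _ (hstate _))
        (hstate _))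
    | zero => rw [map_zero]; exact Submodule.zero_mem _
    | add f g _ _ hf hg => rw [map_add]; exact Submodule.add_mem _ hf hg
    | smul c f _ hf => rw [map_smul]; exact Submodule.smul_mem _ _ hf
  have hdir : ∀ f, posDir v f = ∑ k, ((inner ℝ (M.u k) v : ℝ) : ℂ) • posDir (M.u k) f := by
    intro f
    ext x
    rw [posDir_apply, sum_apply]
    simp only [smul_apply, posDir_apply, smul_eq_mul, ← mul_assoc, ← Finset.sum_mul]
    congr 1
    rw [← M.u.sum_inner_mul_inner v x]
    push_cast
    exact Finset.sum_congr rfl fun k _ => by rw [real_inner_comm]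
  induction n with
  | zero => exact hstate 0
  | succ n ih =>
    rw [Function.iterate_succ_apply', hdir]
    exact Submodule.sum_mem _ fun k _ => Submodule.smul_mem _ _ (hmode k _ ih)

/-- Completeness of the occupation-number states in `L²`. -/
theorem span_normState_dense :
    (Submodule.span ℂ
      (Set.range fun s => toHilb L (M.system.normState s))).topologicalClosure = ⊤ := by
  rw [Submodule.topologicalClosure_eq_top_iff, Submodule.eq_bot_iff]
  intro F hF
  rw [Submodule.mem_orthogonal] at hF
  have hstate : ∀ s, inner ℂ (toHilb L (M.system.state s)) F = 0 := by
    intro s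
    have h1 := hF _ (Submodule.subset_span ⟨s, rfl⟩)
    have h2 := norm_ne_zero_iff.2 (M.system.emb_state_ne_zero s)
    simp only [LadderSystem.normState, map_smul, inner_smul_left, mul_eq_zero] at h1
    rcases h1 with h1 | h1
    · rw [Complex.conj_ofReal] at h1
      exact absurd (Complex.ofReal_eq_zero.1 h1) (inv_ne_zero h2)
    · exact h1
  have hspan : ∀ f ∈ Submodule.span ℂ (Set.range M.system.state),
      inner ℂ (toHilb L f) F = 0 := by
    intro f hf
    induction hf using Submodule.span_induction with
    | mem f hf => obtain ⟨s, rfl⟩ := hf; exact hstate s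
    | zero => simp
    | add f g _ _ hf hg => rw [map_add, inner_add_left, hf, hg, add_zero]
    | smul c f _ hf => rw [map_smul, inner_smul_left, hf, mul_zero]
  refine eq_zero_of_gaussian_moments (hq := modeForm_hasTemperateGrowth M.u M.α)
    (hc := modeForm_coercive M.u M.α_pos) fun v n => ?_
  rw [← hspan _ (M.posDir_pow_vacuum_mem v n), L2.inner_def]
  refine integral_congr_ae ?_
  filter_upwards [SchwartzMap.coeFn_toLp (((posDir v)^[n]) M.vacuum) 2 volume] with x hx
  have hx' : (toHilb L (((posDir v)^[n]) M.vacuum) : Config L → ℂ) x =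
    ((posDir v)^[n]) M.vacuum x := hx
  rw [hx', posDir_pow_apply, RCLike.inner_apply', map_mul, map_pow]
  simp only [vacuum_apply, gaussian_apply, Complex.conj_ofReal]
  ring

end NormalModes

end Modes

/-! ### The Hamiltonian in normal modes -/

section Quadratic

variable {L : Type*} [Fintype L] [DecidableEq L]

/-- A quadratic form in operators `D i` is diagonal in the operators `E k` of an eigenbasis of its
coefficient matrix. -/
theorem quadratic_eq_sum {V : Type*} [AddCommGroup V] [Module ℂ V]
    {u : OrthonormalBasis L ℝ (EuclideanSpace ℝ L)} {M : Matrix L L ℝ} {c : L → ℝ}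
    (hM : ∀ k, M *ᵥ (u k).ofLp = c k • (u k).ofLp) {D E : L → V →ₗ[ℂ] V}
    (hD : ∀ i f, D i f = ∑ k, ((u k i : ℝ) : ℂ) • E k f) (f : V) :
    ∑ i, ∑ j, ((M i j : ℝ) : ℂ) • D i (D j f) = ∑ k, ((c k : ℝ) : ℂ) • E k (E k f) := by
  have hE : ∀ k f, ∑ i, ((u k i : ℝ) : ℂ) • D i f = E k f := by
    intro k f
    simp_rw [hD, Finset.smul_sum, smul_smul]
    rw [Finset.sum_comm]
    simp_rw [← Finset.sum_smul, ← Complex.ofReal_mul, ← Complex.ofReal_sum, eigenbasis_orthonormal]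
    simp
  have h1 : ∀ i j, ((M i j : ℝ) : ℂ) • D i (D j f) =
      ∑ k, ((c k : ℝ) : ℂ) • ((u k i : ℝ) : ℂ) • D i (((u k j : ℝ) : ℂ) • D j f) := by
    intro i j
    rw [entry_eq_sum hM i j, Complex.ofReal_sum, Finset.sum_smul]
    refine Finset.sum_congr rfl fun k _ => ?_
    rw [map_smul, smul_smul, smul_smul]
    congr 1
    push_cast
    ring
  calc ∑ i, ∑ j, ((M i j : ℝ) : ℂ) • D i (D j f)
      = ∑ i, ∑ k, ∑ j, ((c k : ℝ) : ℂ) • ((u k i : ℝ) : ℂ) •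
          D i (((u k j : ℝ) : ℂ) • D j f) := by
        refine Finset.sum_congr rfl fun i _ => ?_
        rw [Finset.sum_comm]
        exact Finset.sum_congr rfl fun j _ => h1 i j
    _ = ∑ i, ∑ k, ((c k : ℝ) : ℂ) • ((u k i : ℝ) : ℂ) • D i (E k f) := by
        refine Finset.sum_congr rfl fun i _ => Finset.sum_congr rfl fun k _ => ?_
        rw [← hE k f, map_sum, Finset.smul_sum, Finset.smul_sum]
    _ = ∑ k, ((c k : ℝ) : ℂ) • E k (E k f) := by
        rw [Finset.sum_comm]
        refine Finset.sum_congr rfl fun k _ => ?_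
        rw [← Finset.smul_sum, hE]

variable {u : OrthonormalBasis L ℝ (EuclideanSpace ℝ L)} {Vx Vp : Matrix L L ℝ} {a b : L → ℝ}

theorem hamiltonian_eq_sum (ha : ∀ k, Vx *ᵥ (u k).ofLp = a k • (u k).ofLp)
    (hb : ∀ k, Vp *ᵥ (u k).ofLp = b k • (u k).ofLp) (f : 𝓢(Config L, ℂ)) :
    hamiltonian Vx Vp f = ∑ k, (((b k : ℝ) : ℂ) • momDir (u k) (momDir (u k) f) +
      ((a k : ℝ) : ℂ) • posDir (u k) (posDir (u k) f)) := by
  have hp := quadratic_eq_sum hb (D := fun i => (momentum i : 𝓢(Config L, ℂ) →L[ℂ] _).toLinearMap)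
    (E := fun k => (momDir (u k)).toLinearMap) (momentum_eq_sum u) f
  have hx := quadratic_eq_sum ha (D := fun i => (position i : 𝓢(Config L, ℂ) →L[ℂ] _).toLinearMap)
    (E := fun k => (posDir (u k)).toLinearMap) (position_eq_sum u) f
  simp only [ContinuousLinearMap.coe_coe] at hp hx
  rw [Finset.sum_add_distrib, ← hp, ← hx]
  simp [hamiltonian]

theorem inner_hamiltonian (ha : ∀ k, Vx *ᵥ (u k).ofLp = a k • (u k).ofLp)
    (hb : ∀ k, Vp *ᵥ (u k).ofLp = b k • (u k).ofLp) (f g : 𝓢(Config L, ℂ)) :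
    inner ℂ (toHilb L (hamiltonian Vx Vp f)) (toHilb L g) =
      inner ℂ (toHilb L f) (toHilb L (hamiltonian Vx Vp g)) := by
  simp only [hamiltonian_eq_sum ha hb, map_sum, map_add, map_smul, sum_inner, inner_sum,
    inner_add_left, inner_add_right, inner_smul_left, inner_smul_right, inner_momDir,
    inner_posDir, Complex.conj_ofReal]

/-- The normal modes of the Hamiltonian: `α² = a/(2ω)` with `ω² = a b` makes
`b P² + a X² = ω (2 A† A + 1)`. -/
def normalModes (u : OrthonormalBasis L ℝ (EuclideanSpace ℝ L)) (a b : L → ℝ)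
    (ha0 : ∀ k, 0 < a k) (hb0 : ∀ k, 0 < b k) : NormalModes L where
  u := u
  α k := √(a k / (2 * √(a k * b k)))
  β k := 1 / (2 * √(a k / (2 * √(a k * b k))))
  α_pos k := by have := ha0 k; have := hb0 k; positivity
  two_mul_α_β k := by
    have : 0 < √(a k / (2 * √(a k * b k))) := by have := ha0 k; have := hb0 k; positivity
    field_simp

variable (ha0 : ∀ k, 0 < a k) (hb0 : ∀ k, 0 < b k)

/-- The variance scales of position and momentum in the mode `k`. -/
theorem normalModes_scales {L : Type*} [Fintype L] {u : OrthonormalBasis L ℝ (EuclideanSpace ℝ L)}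
    {a b : L → ℝ} (ha0 : ∀ k, 0 < a k) (hb0 : ∀ k, 0 < b k) (k : L) :
    (1 / (2 * (normalModes u a b ha0 hb0).α k)) ^ 2 = b k / (2 * √(a k * b k)) ∧
    (1 / (2 * (normalModes u a b ha0 hb0).β k)) ^ 2 = a k / (2 * √(a k * b k)) := by
  have h1 := ha0 k
  have h2 := hb0 k
  have hω : 0 < √(a k * b k) := by positivity
  have hω2 : √(a k * b k) ^ 2 = a k * b k := Real.sq_sqrt (by positivity)
  have hα2 : √(a k / (2 * √(a k * b k))) ^ 2 = a k / (2 * √(a k * b k)) :=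
    Real.sq_sqrt (by positivity)
  have hα : 0 < √(a k / (2 * √(a k * b k))) := by positivity
  constructor
  · show (1 / (2 * √(a k / (2 * √(a k * b k))))) ^ 2 = _
    rw [div_pow, mul_pow, hα2]
    field_simp
    linarith
  · show (1 / (2 * (1 / (2 * √(a k / (2 * √(a k * b k))))))) ^ 2 = _
    have e : ∀ x : ℝ, 0 < x → (1 / (2 * (1 / (2 * x)))) ^ 2 = x ^ 2 := fun x hx => by field_simp
    rw [e _ hα, hα2]

variable [Nonempty L]

/-- The occupation-number states are eigenvectors of the Hamiltonian.  With the scales of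
`normalModes` the terms `A A` and `A† A†` of position and momentum cancel. -/
theorem hamiltonian_state (ha : ∀ k, Vx *ᵥ (u k).ofLp = a k • (u k).ofLp)
    (hb : ∀ k, Vp *ᵥ (u k).ofLp = b k • (u k).ofLp) (s : Multiset L) :
    hamiltonian Vx Vp ((normalModes u a b ha0 hb0).system.state s) =
      ((∑ k, √(a k * b k) * (2 * s.count k + 1) : ℝ) : ℂ) •
        (normalModes u a b ha0 hb0).system.state s := by
  set M := normalModes u a b ha0 hb0 with hM
  set S := M.system with hS
  rw [hamiltonian_eq_sum ha hb, Complex.ofReal_sum, Finset.sum_smul]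
  refine Finset.sum_congr rfl fun k _ => ?_
  obtain ⟨hx, hp⟩ := normalModes_scales (u := u) ha0 hb0 k
  rw [← hM] at hx hp
  have h1 := ha0 k
  have h2 := hb0 k
  have hω : 0 < √(a k * b k) := by positivity
  have hω2 : √(a k * b k) ^ 2 = a k * b k := Real.sq_sqrt (by positivity)
  have ex : a k * (1 / (2 * M.α k)) ^ 2 = √(a k * b k) / 2 := by
    rw [hx]; field_simp; linarith
  have ep : b k * (1 / (2 * M.β k)) ^ 2 = √(a k * b k) / 2 := by
    rw [hp, mul_div_assoc', div_eq_div_iff (by positivity) two_ne_zero]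
    linear_combination -2 * hω2
  set f := S.state s with hf
  have eX : posDir (u k) (posDir (u k) f) = (((1 / (2 * M.α k)) ^ 2 : ℝ) : ℂ) •
      (S.ann k (S.ann k f) + S.ann k (S.cre k f) + S.cre k (S.ann k f) + S.cre k (S.cre k f)) := by
    have h : ∀ f, posDir (u k) f = _ := M.posDir_eq k
    rw [h, h]
    simp only [map_smul, map_add, ← hS]
    push_cast
    module
  have eP : momDir (u k) (momDir (u k) f) = (-((1 / (2 * M.β k)) ^ 2 : ℝ) : ℂ) •
      (S.ann k (S.ann k f) - S.ann k (S.cre k f) - S.cre k (S.ann k f) + S.cre k (S.cre k f)) := by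
    have h : ∀ f, momDir (u k) f = _ := M.momDir_eq k
    rw [h, h]
    simp only [map_smul, map_sub, ← hS]
    rw [← smul_sub, smul_smul]
    have hc : (-Complex.I * (1 / (2 * M.β k) : ℝ)) * (-Complex.I * (1 / (2 * M.β k) : ℝ)) =
        (-((1 / (2 * M.β k)) ^ 2 : ℝ) : ℂ) := by
      push_cast
      linear_combination (1 / (2 * (M.β k : ℂ))) ^ 2 * Complex.I_sq
    rw [hc]
    module
  rw [eX, eP, smul_smul, smul_smul]
  have ex' : ((a k : ℝ) : ℂ) * (((1 / (2 * M.α k)) ^ 2 : ℝ) : ℂ) =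
      ((√(a k * b k) / 2 : ℝ) : ℂ) := by
    rw [← Complex.ofReal_mul, ex]
  have ep' : ((b k : ℝ) : ℂ) * (-((1 / (2 * M.β k)) ^ 2 : ℝ) : ℂ) =
      -((√(a k * b k) / 2 : ℝ) : ℂ) := by
    rw [mul_neg, ← Complex.ofReal_mul, ep]
  rw [ex', ep', S.ann_cre, if_pos rfl, S.cre_ann_state]
  push_cast
  module

end Quadratic

/-! ### Thermal averages -/

section Thermal

variable {L : Type*} [Fintype L] [DecidableEq L] {M : NormalModes L} {T : ℝ}
  {ω : L → ℝ}

/-- The Boltzmann weight `exp (-E / T)` of an occupation-number state, of energy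
`E = ∑ k, ω k * (2 * s.count k + 1)`. -/
def boltzmannWeight (ω : L → ℝ) (T : ℝ) (s : Multiset L) : ℝ :=
  Real.exp (-(∑ k, ω k * (2 * s.count k + 1)) / T)

theorem boltzmannWeight_eq (s : Multiset L) : boltzmannWeight ω T s =
    Real.exp (-(∑ k, ω k) / T) * (s.map fun k => Real.exp (-(2 * ω k / T))).prod := by
  rw [multiset_prod_map_eq, boltzmannWeight]
  simp_rw [← Real.exp_nat_mul]
  rw [← Real.exp_sum, ← Real.exp_add]
  congr 1
  rw [neg_div, neg_div, Finset.sum_div, Finset.sum_div, ← Finset.sum_neg_distrib,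
    ← Finset.sum_neg_distrib, ← Finset.sum_add_distrib]
  exact Finset.sum_congr rfl fun k _ => by ring

theorem boltzmannWeight_nonneg (s : Multiset L) : 0 ≤ boltzmannWeight ω T s := (Real.exp_pos _).le

theorem exp_level_lt_one {κ : Type*} {ω : κ → ℝ} (hT : 0 < T) (hω : ∀ k, 0 < ω k)
    (k : κ) : Real.exp (-(2 * ω k / T)) < 1 := by
  rw [Real.exp_lt_one_iff]
  have := hω k
  have : 0 < 2 * ω k / T := by positivity
  linarith

variable (hT : 0 < T) (hω : ∀ k, 0 < ω k)
include hT hω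

theorem summable_boltzmannWeight : Summable (boltzmannWeight ω T) := by
  have := (summable_multiset_prod (fun k => (Real.exp_pos _).le)
    (exp_level_lt_one hT hω)).mul_left (Real.exp (-(∑ k, ω k) / T))
  exact this.congr fun s => (boltzmannWeight_eq s).symm

theorem tsum_boltzmannWeight_pos : 0 < ∑' s, boltzmannWeight ω T s :=
  (summable_boltzmannWeight hT hω).tsum_pos boltzmannWeight_nonneg 0 (Real.exp_pos _)

/-- The thermal average of a function that is linear in the occupation numbers. -/
theorem hasSum_boltzmannWeight_mul (r : L → ℝ) :
    HasSum (fun s => boltzmannWeight ω T s * ∑ k, r k * (2 * s.count k + 1))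
      ((∑ k, r k * (ω k * thermal T (ω k))) * ∑' s, boltzmannWeight ω T s) := by
  rw [Finset.sum_mul]
  simp_rw [Finset.mul_sum]
  refine hasSum_sum fun k _ => ?_
  set x : L → ℝ := fun k => Real.exp (-(2 * ω k / T)) with hx
  have h1 := ((hasSum_count_mul_multiset_prod (x := x) (fun k => Real.exp_pos _)
    (exp_level_lt_one hT hω) k).mul_left (2 * r k * Real.exp (-(∑ k, ω k) / T)))
  have h2 := (summable_boltzmannWeight hT hω).hasSum.mul_left (r k)
  have hZ : ∑' s, boltzmannWeight ω T s =
      Real.exp (-(∑ k, ω k) / T) * ∑' s : Multiset L, (s.map x).prod := by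
    rw [← tsum_mul_left]
    exact tsum_congr fun s => boltzmannWeight_eq s
  have hxlt : x k < 1 := exp_level_lt_one hT hω k
  have hth : ω k * thermal T (ω k) = 1 + 2 * (x k / (1 - x k)) := by
    have hx0 : 0 < x k := Real.exp_pos _
    have e : Real.exp (2 * ω k / T) = (x k)⁻¹ := by rw [hx, ← Real.exp_neg, neg_neg]
    have h3 : 1 - x k ≠ 0 := by linarith
    have h4 := (hω k).ne'
    rw [thermal, e]
    have h5 : (x k)⁻¹ - 1 = (1 - x k) / x k := by field_simp
    rw [h5]
    field_simp
  have hval : r k * (ω k * thermal T (ω k)) * ∑' s, boltzmannWeight ω T s =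
      2 * r k * Real.exp (-(∑ k, ω k) / T) * (x k / (1 - x k) * ∑' s : Multiset L, (s.map x).prod) +
        r k * ∑' s, boltzmannWeight ω T s := by
    rw [hth, hZ]
    ring
  rw [hval]
  refine (h1.add h2).congr_fun fun s => ?_
  rw [boltzmannWeight_eq]
  ring

theorem summable_boltzmannWeight_mul_card (C : ℝ) :
    Summable fun s => boltzmannWeight ω T s * (C * (s.card + 2)) := by
  have := (summable_card_mul_multiset_prod (fun k => Real.exp_pos _)
    (exp_level_lt_one hT hω)).mul_left (C * Real.exp (-(∑ k, ω k) / T))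
  refine this.congr fun s => ?_
  rw [boltzmannWeight_eq]
  ring

variable [Nonempty L]

/-- Trace of the Boltzmann operator times a product of two fields; `A'` is the adjoint of `A`. -/
theorem hasTrace_diagonal {A A' : 𝓢(Config L, ℂ) →L[ℂ] 𝓢(Config L, ℂ)}
    (hadj : ∀ f g, inner ℂ (toHilb L f) (toHilb L (A g)) = inner ℂ (toHilb L (A' f)) (toHilb L g))
    {c d c' d' : L → ℂ} (hA' : ∀ f, A' f = M.system.field c d (M.system.field c' d' f))
    {r : L → ℝ} (hr : ∀ k, c k * d' k = r k) (hr' : ∀ k, d k * c' k = r k) :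
    HasTrace ((diagonal (fun s => toHilb L (M.system.normState s)) (boltzmannWeight ω T)) ∘L
        toHilb L ∘L A)
      (((∑ k, r k * (ω k * thermal T (ω k))) * ∑' s, boltzmannWeight ω T s : ℝ) : ℂ) := by
  rintro e ⟨heo, hed⟩
  have hs := summable_boltzmannWeight hT hω
  refine hasSum_inner_diagonal (φ := fun s => toHilb L (M.system.normState s))
    (ψ := fun n => toHilb L (A (e n))) (χ := fun s => toHilb L (A' (M.system.normState s)))
    M.system.orthonormal_normState boltzmannWeight_nonneg hs heo hed (fun n s => hadj _ _) ?_ ?_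
  · obtain ⟨C, hC⟩ := M.system.norm_field_field_le c d c' d'
    refine Summable.of_nonneg_of_le
      (fun s => mul_nonneg (boltzmannWeight_nonneg s) (norm_nonneg _)) (fun s => ?_)
      (summable_boltzmannWeight_mul_card hT hω C)
    refine mul_le_mul_of_nonneg_left ?_ (boltzmannWeight_nonneg s)
    rw [hA']
    exact hC s
  · have h := Complex.hasSum_ofReal.2 (hasSum_boltzmannWeight_mul hT hω r)
    refine h.congr_fun fun s => ?_
    rw [Complex.ofReal_mul]
    congr 1
    rw [← inner_conj_symm, hA']
    have := M.system.inner_field_field c d c' d' s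
    rw [NormalModes.system_emb, NormalModes.system_emb] at this
    rw [this]
    have e : ∑ k, (c k * d' k * (s.count k + 1) + d k * c' k * s.count k) =
        ((∑ k, r k * (2 * s.count k + 1) : ℝ) : ℂ) := by
      push_cast
      refine Finset.sum_congr rfl fun k _ => ?_
      rw [hr, hr']
      ring
    rw [e, Complex.conj_ofReal]

theorem hasTrace_boltzmann :
    HasTrace ((diagonal (fun s => toHilb L (M.system.normState s)) (boltzmannWeight ω T)) ∘L
      toHilb L) ((∑' s, boltzmannWeight ω T s : ℝ) : ℂ) := by
  rintro e ⟨heo, hed⟩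
  have hs := summable_boltzmannWeight hT hω
  have hn := M.system.orthonormal_normState.1
  refine hasSum_inner_diagonal (φ := fun s => toHilb L (M.system.normState s))
    (ψ := fun n => toHilb L (e n)) (χ := fun s => toHilb L (M.system.normState s))
    M.system.orthonormal_normState boltzmannWeight_nonneg hs heo hed (fun n s => rfl) ?_ ?_
  · refine hs.congr fun s => ?_
    rw [← NormalModes.system_emb, hn, mul_one]
  · refine (Complex.hasSum_ofReal.2 hs.hasSum).congr_fun fun s => ?_
    rw [LadderSystem.inner_self_eq_ofReal, ← NormalModes.system_emb, hn]
    simp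

end Thermal

/-! ### The Gibbs state and its correlations -/

section Correlations

theorem frequency_pos {κ : Type*} {a b : κ → ℝ} (ha0 : ∀ k, 0 < a k) (hb0 : ∀ k, 0 < b k) (k : κ) :
    0 < √(a k * b k) :=
  Real.sqrt_pos.2 (mul_pos (ha0 k) (hb0 k))

variable {L : Type*} [Fintype L] {u : OrthonormalBasis L ℝ (EuclideanSpace ℝ L)}
  {Vx Vp : Matrix L L ℝ} {a b : L → ℝ} {T : ℝ}

/-- The variance `c / (2 ω)` of a mode times its thermal factor `coth (ω / T)`. -/
theorem half_sum_thermal (ha0 : ∀ k, 0 < a k) (hb0 : ∀ k, 0 < b k) (c : L → ℝ) (i j : L) :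
    ∑ k, u k i * u k j * (c k / (2 * √(a k * b k))) *
        (√(a k * b k) * thermal T √(a k * b k)) =
      (∑ k, u k i * u k j * c k * thermal T (√(a k * b k))) / 2 := by
  rw [Finset.sum_div]
  refine Finset.sum_congr rfl fun k _ => ?_
  have := frequency_pos ha0 hb0 k
  field_simp

variable [DecidableEq L] [Nonempty L] (ha0 : ∀ k, 0 < a k) (hb0 : ∀ k, 0 < b k)

/-- The Boltzmann operator of the normal modes. -/
def boltzmann (u : OrthonormalBasis L ℝ (EuclideanSpace ℝ L)) (ha0 : ∀ k, 0 < a k)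
    (hb0 : ∀ k, 0 < b k) (T : ℝ) : Hilb L →L[ℂ] Hilb L :=
  diagonal (fun s => toHilb L ((normalModes u a b ha0 hb0).system.normState s))
    (boltzmannWeight (fun k => √(a k * b k)) T)

theorem hamiltonian_normState (ha : ∀ k, Vx *ᵥ (u k).ofLp = a k • (u k).ofLp)
    (hb : ∀ k, Vp *ᵥ (u k).ofLp = b k • (u k).ofLp) (s : Multiset L) :
    hamiltonian Vx Vp ((normalModes u a b ha0 hb0).system.normState s) =
      ((∑ k, √(a k * b k) * (2 * s.count k + 1) : ℝ) : ℂ) •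
        (normalModes u a b ha0 hb0).system.normState s := by
  rw [LadderSystem.normState, map_smul, hamiltonian_state ha0 hb0 ha hb, smul_comm]

/-- An enumeration of the occupation-number states is a Schwartz basis. -/
theorem exists_isSchwartzBasis (M : NormalModes L) :
    ∃ ε : ℕ ≃ Multiset L, IsSchwartzBasis fun n => M.system.normState (ε n) := by
  have : Infinite (Multiset L) := by
    refine Infinite.of_injective (fun n : ℕ => Multiset.replicate n (Classical.arbitrary L))
      fun m n h => ?_
    simpa using congrArg Multiset.card h
  obtain ⟨_⟩ := nonempty_denumerable (Multiset L)
  let ε := (Denumerable.eqv (Multiset L)).symm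
  refine ⟨ε, M.system.orthonormal_normState.comp ε ε.injective, ?_⟩
  have : (Set.range fun n => toHilb L (M.system.normState (ε n))) =
      Set.range fun s => toHilb L (M.system.normState s) :=
    ε.surjective.range_comp fun s => toHilb L (M.system.normState s)
  rw [this]
  exact M.span_normState_dense

variable (hT : 0 < T)
include hT

theorem isBoltzmannOperator_boltzmann (ha : ∀ k, Vx *ᵥ (u k).ofLp = a k • (u k).ofLp)
    (hb : ∀ k, Vp *ᵥ (u k).ofLp = b k • (u k).ofLp) :
    IsBoltzmannOperator (hamiltonian Vx Vp) T (boltzmann u ha0 hb0 T) := by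
  obtain ⟨ε, hε⟩ := exists_isSchwartzBasis (normalModes u a b ha0 hb0)
  refine ⟨_, fun n => ∑ k, √(a k * b k) * (2 * (ε n).count k + 1), hε,
    fun n => hamiltonian_normState ha0 hb0 ha hb _, fun n => ?_⟩
  exact diagonal_apply_self (normalModes u a b ha0 hb0).system.orthonormal_normState
    boltzmannWeight_nonneg (summable_boltzmannWeight hT (frequency_pos ha0 hb0)) (ε n)

/-- The Gibbs state is unique: it is the normalised Boltzmann operator of the normal modes. -/
theorem isGibbsState_iff (ha : ∀ k, Vx *ᵥ (u k).ofLp = a k • (u k).ofLp)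
    (hb : ∀ k, Vp *ᵥ (u k).ofLp = b k • (u k).ofLp) (ρ : Hilb L →L[ℂ] Hilb L) :
    IsGibbsState Vx Vp T ρ ↔
      ρ = ((∑' s, boltzmannWeight (fun k => √(a k * b k)) T s : ℝ) : ℂ)⁻¹ •
        boltzmann u ha0 hb0 T := by
  have hω := frequency_pos ha0 hb0
  have hs := summable_boltzmannWeight hT hω
  have htr := hasTrace_boltzmann (M := normalModes u a b ha0 hb0) hT hω
  constructor
  · rintro ⟨B, Z, hB, hZ, -, rfl⟩
    have hBeq : B = boltzmann u ha0 hb0 T :=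
      eq_diagonal_of_isBoltzmannOperator (inner_hamiltonian ha hb)
        (normalModes u a b ha0 hb0).system.orthonormal_normState
        (normalModes u a b ha0 hb0).span_normState_dense
        (fun s => hamiltonian_normState ha0 hb0 ha hb s) hs hB
    obtain ⟨ε, hε⟩ := exists_isSchwartzBasis (normalModes u a b ha0 hb0)
    rw [hBeq] at hZ
    rw [hBeq, (hZ _ hε).unique (htr _ hε)]
  · rintro rfl
    refine ⟨_, _, isBoltzmannOperator_boltzmann ha0 hb0 hT ha hb, htr, ?_, rfl⟩
    exact_mod_cast (tsum_boltzmannWeight_pos hT hω).ne'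

/-- Expectation values in the Gibbs state, for a product `A` of two fields with adjoint `A'`. -/
theorem hasExpectation_gibbs {A A' : 𝓢(Config L, ℂ) →L[ℂ] 𝓢(Config L, ℂ)}
    (hadj : ∀ f g, inner ℂ (toHilb L f) (toHilb L (A g)) = inner ℂ (toHilb L (A' f)) (toHilb L g))
    {c d c' d' : L → ℂ} (hA' : ∀ f, A' f = (normalModes u a b ha0 hb0).system.field c d
      ((normalModes u a b ha0 hb0).system.field c' d' f))
    {r : L → ℝ} (hr : ∀ k, c k * d' k = r k) (hr' : ∀ k, d k * c' k = r k) :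
    HasExpectation (((∑' s, boltzmannWeight (fun k => √(a k * b k)) T s : ℝ) : ℂ)⁻¹ •
        boltzmann u ha0 hb0 T) A
      ((∑ k, r k * (√(a k * b k) * thermal T √(a k * b k)) : ℝ) : ℂ) := by
  have hω := frequency_pos ha0 hb0
  intro e he
  have h := (hasTrace_diagonal hT hω hadj hA' hr hr' e he).mul_left
    ((∑' s, boltzmannWeight (fun k => √(a k * b k)) T s : ℝ) : ℂ)⁻¹
  have hZ : ((∑' s, boltzmannWeight (fun k => √(a k * b k)) T s : ℝ) : ℂ) ≠ 0 := by
    exact_mod_cast (tsum_boltzmannWeight_pos hT hω).ne'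
  rw [Complex.ofReal_mul, mul_comm, mul_assoc, mul_inv_cancel₀ hZ, mul_one] at h
  refine h.congr_fun fun n => ?_
  simp only [ContinuousLinearMap.comp_apply, smul_apply, inner_smul_right]
  rfl

theorem hasExpectation_position (i j : L) :
    HasExpectation (((∑' s, boltzmannWeight (fun k => √(a k * b k)) T s : ℝ) : ℂ)⁻¹ •
        boltzmann u ha0 hb0 T) (position i ∘L position j)
      (((∑ k, u k i * u k j * b k * thermal T (√(a k * b k))) / 2 : ℝ) : ℂ) := by
  set M := normalModes u a b ha0 hb0 with hM
  have hpos : ∀ (i : L) f, position i f =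
      M.system.field (fun k => (u k i * (1 / (2 * M.α k)) : ℝ))
        (fun k => (u k i * (1 / (2 * M.α k)) : ℝ)) f := by
    intro i f
    rw [position_eq_sum u, LadderSystem.field_apply]
    refine Finset.sum_congr rfl fun k _ => ?_
    rw [show posDir (u k) f = _ from M.posDir_eq k f, smul_smul, smul_add, Complex.ofReal_mul]
  have hsym : ∀ (i : L) f g, inner ℂ (toHilb L (position i f)) (toHilb L g) =
      inner ℂ (toHilb L f) (toHilb L (position i g)) := by
    intro i f g
    simp only [position_eq_sum u, map_sum, map_smul, sum_inner, inner_sum, inner_smul_left,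
      inner_smul_right, inner_posDir, Complex.conj_ofReal]
  rw [← half_sum_thermal ha0 hb0]
  refine hasExpectation_gibbs ha0 hb0 hT (A' := position j ∘L position i)
    (fun f g => ?_) (fun f => by rw [ContinuousLinearMap.comp_apply, hpos, hpos])
    (fun k => ?_) (fun k => ?_)
  · rw [ContinuousLinearMap.comp_apply, ContinuousLinearMap.comp_apply, hsym, hsym]
  all_goals
    rw [← Complex.ofReal_mul, ← (normalModes_scales (u := u) ha0 hb0 k).1, ← hM]
    congr 1
    ring

theorem hasExpectation_momentum (i j : L) :
    HasExpectation (((∑' s, boltzmannWeight (fun k => √(a k * b k)) T s : ℝ) : ℂ)⁻¹ •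
        boltzmann u ha0 hb0 T) (momentum i ∘L momentum j)
      (((∑ k, u k i * u k j * a k * thermal T (√(a k * b k))) / 2 : ℝ) : ℂ) := by
  set M := normalModes u a b ha0 hb0 with hM
  have hmom : ∀ (i : L) f, momentum i f =
      M.system.field (fun k => -Complex.I * (u k i * (1 / (2 * M.β k)) : ℝ))
        (fun k => Complex.I * (u k i * (1 / (2 * M.β k)) : ℝ)) f := by
    intro i f
    rw [momentum_eq_sum u, LadderSystem.field_apply]
    refine Finset.sum_congr rfl fun k _ => ?_
    rw [show momDir (u k) f = _ from M.momDir_eq k f, smul_smul, Complex.ofReal_mul]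
    module
  have hsym : ∀ (i : L) f g, inner ℂ (toHilb L (momentum i f)) (toHilb L g) =
      inner ℂ (toHilb L f) (toHilb L (momentum i g)) := by
    intro i f g
    simp only [momentum_eq_sum u, map_sum, map_smul, sum_inner, inner_sum, inner_smul_left,
      inner_smul_right, inner_momDir, Complex.conj_ofReal]
  rw [← half_sum_thermal ha0 hb0]
  refine hasExpectation_gibbs ha0 hb0 hT (A' := momentum j ∘L momentum i)
    (fun f g => ?_) (fun f => by rw [ContinuousLinearMap.comp_apply, hmom, hmom])
    (fun k => ?_) (fun k => ?_)
  · rw [ContinuousLinearMap.comp_apply, ContinuousLinearMap.comp_apply, hsym, hsym]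
  all_goals
    rw [← (normalModes_scales (u := u) ha0 hb0 k).2, ← hM]
    push_cast
    linear_combination (-(u k i : ℂ) * u k j * (1 / (2 * (M.β k : ℂ))) ^ 2) * Complex.I_sq

end Correlations

end HarmonicLattice

end

theorem theorem4 {L : Type*} [Fintype L] [DecidableEq L] (G : SimpleGraph L) (hG : G.Connected)
    (Vx Vp : Matrix L L ℝ) (hVx : Vx.PosDef) (hVp : Vp.PosDef) (hcomm : Commute Vx Vp)
    (m : ℕ) (hm : 1 ≤ m)
    (hrx : HarmonicLattice.HasRange G m Vx) (hrp : HarmonicLattice.HasRange G m Vp)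
    (l₀ ν : ℝ) (hl₀ : 0 ≤ l₀) (hν : 0 < ν)
    (hlat : HarmonicLattice.LatticeStructure G Vx Vp m l₀ ν)
    (T : ℝ) (hT : 0 < T) :
    (∃ ρ, HarmonicLattice.IsGibbsState Vx Vp T ρ) ∧
    ∀ ρ, HarmonicLattice.IsGibbsState Vx Vp T ρ →
      ∀ i j : L, m ≤ G.dist i j →
        (∃ cx : ℂ,
          HarmonicLattice.HasExpectation ρ
            (HarmonicLattice.position i ∘L HarmonicLattice.position j) cx ∧
          ‖cx‖ ≤ HarmonicLattice.prefactor G Vx Vp m l₀ T * HarmonicLattice.opNorm Vp *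
            Real.exp (-(G.dist i j / HarmonicLattice.correlationLength Vx Vp m ν))) ∧
        (∃ cp : ℂ,
          HarmonicLattice.HasExpectation ρ
            (HarmonicLattice.momentum i ∘L HarmonicLattice.momentum j) cp ∧
          ‖cp‖ ≤ HarmonicLattice.prefactor G Vx Vp m l₀ T * HarmonicLattice.opNorm Vx *
            Real.exp (-(G.dist i j / HarmonicLattice.correlationLength Vx Vp m ν))) := by
  have := hG.nonempty
  obtain ⟨u, a, b, ha, hb⟩ := HarmonicLattice.exists_joint_eigenbasis hVx.1 hVp.1 hcomm
  have ha0 := HarmonicLattice.eigenvalue_pos hVx ha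
  have hb0 := HarmonicLattice.eigenvalue_pos hVp hb
  have hiff := HarmonicLattice.isGibbsState_iff (Vx := Vx) (Vp := Vp) ha0 hb0 hT ha hb
  have hhalf : ∀ {x y : ℝ}, |x| ≤ y → ‖((x / 2 : ℝ) : ℂ)‖ ≤ y := by
    intro x y h
    rw [Complex.norm_real, Real.norm_eq_abs, abs_div, abs_two]
    linarith [abs_nonneg x]
  refine ⟨⟨_, (hiff _).2 rfl⟩, ?_⟩
  rintro ρ hρ i j hij
  obtain rfl := (hiff ρ).1 hρ
  exact ⟨⟨_, HarmonicLattice.hasExpectation_position ha0 hb0 hT i j,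
      hhalf (HarmonicLattice.abs_correlation_le hG ha hb ha0 hb0 hm hrx hrp hlat hT hrp hb hij)⟩,
    ⟨_, HarmonicLattice.hasExpectation_momentum ha0 hb0 hT i j,
      hhalf (HarmonicLattice.abs_correlation_le hG ha hb ha0 hb0 hm hrx hrp hlat hT hrx ha hij)⟩⟩
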